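/- Let $\alpha>0$, let $\widetilde{\mathbb{C}^*}$ be the universal cover of $\mathbb{C}\setminus\{0\}$ (on which $\arg x\in\mathbb{R}$, $\log x$ and the real powers $x^s=e^{s\log x}$ are single valued), and for $(E,\ell)\in\mathbb{C}^2$ consider the holomorphic solutions on $\widetilde{\mathbb{C}^*}$ of $$\frac{d^2\psi}{dx^2}=\Big(x^{2\alpha}+\frac{\ell(\ell+1)}{x^2}-E\Big)\psi .\qquad(\ast)$$ Let $N=\big\lfloor\frac{1+\alpha}{2\alpha}\big\rfloor$, $d_\alpha=\alpha(1+2N)-1$, $e_\alpha=\min\{d_\alpha,\alpha+1\}$, let $c_j$ be the $j$-th Taylor coefficient of $(1-t)^{1/2}$ at $t=0$, and let $$R(x)=\frac{x^{\alpha+1}}{\alpha+1}+\sum_{j=1}^{N}c_jE^j\,\frac{x^{\alpha(1-2j)+1}}{\alpha(1-2j)+1}\quad\text{if }\alpha\ne\tfrac1{2m-1}\text{ for all integers } m\ge1,$$ $$R(x)=\frac{x^{\alpha+1}}{\alpha+1}+\sum_{j=1}^{m-1}c_jE^j\,\frac{x^{\alpha(1-2j)+1}}{\alpha(1-2j)+1}+c_mE^m\log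 x\quad\text{if }\alpha=\tfrac1{2m-1},\ m\ge1 .$$ Theorem. One has $d_\alpha>0$. Let $k\in\mathbb{Z}$. For every $(E,\ell)\in\mathbb{C}^2$ there exists a unique solution $\Psi_k(\cdot\,;E,\ell)$ of $(\ast)$ (the $k$-th Sibuya solution) such that, for every $\varepsilon>0$, $$\Big|\Psi_k(x;E,\ell)\,x^{\alpha/2}\,e^{(-1)^kR(x)}-1\Big|=O\big(|x|^{-e_\alpha}\big)$$ as $x\to\infty$ in the closed subsector $\big|\arg x-\frac{k\pi}{\alpha+1}\big|\le\frac{\pi}{2\alpha+2}-\varepsilon$ of the $k$-th Stokes sector. For each $\varepsilon>0$ the estimate is uniform for $(E,\ell)$ in compact subsets of $\mathbb{C}^2$. Moreover, for every fixed $x\in\widetilde{\mathbb{C}^*}$ the function $(E,\ell)\mapsto\Psi_k(x;E,\ell)$ is entire. -/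

import Mathlib

noncomputable section

namespace AnharmonicOscillator

/-- The universal cover of the punctured plane `ℂ \ {0}`, in its logarithmic coordinate: the point
`p` lies over `x = exp p`, and has modulus `|x| = exp (re p)` and argument `arg x = im p ∈ ℝ`. -/
abbrev Cover : Type := ℂ

namespace Cover

/-- The covering projection `p ↦ x`. -/
def proj (p : Cover) : ℂ := Complex.exp p

/-- The modulus `|x|`. -/
def modulus (p : Cover) : ℝ := Real.exp (Complex.re p)

/-- The (unrestricted, real) argument `arg x`. -/
def argument (p : Cover) : ℝ := Complex.im p

/-- The logarithm `log x`, single valued on the cover. -/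
def log (p : Cover) : ℂ := p

/-- The power `x ^ s = exp (s log x)`, single valued on the cover. -/
def pow (p : Cover) (s : ℝ) : ℂ := Complex.exp ((s : ℂ) * log p)

theorem isCoveringMap_proj :
    IsCoveringMap fun p : Cover => (⟨proj p, Complex.exp_ne_zero p⟩ : {x : ℂ // x ≠ 0}) :=
  Complex.isCoveringMap_exp

theorem proj_eq_polar (p : Cover) :
    proj p = (modulus p : ℂ) * Complex.exp ((argument p : ℂ) * Complex.I) := by
  rw [proj, modulus, argument, Complex.ofReal_exp, ← Complex.exp_add, Complex.re_add_im]

end Cover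

/-- The derivative `dψ/dx` of a function on the cover with respect to the local coordinate
`x = exp p`, so that `d/dx = exp (-p) d/dp`. -/
def xDeriv (ψ : Cover → ℂ) (p : Cover) : ℂ := deriv ψ p / Cover.proj p

/-- For a function pulled back from the punctured plane, `xDeriv` is the ordinary derivative. -/
theorem xDeriv_comp_proj (f : ℂ → ℂ) (p : Cover) (hf : DifferentiableAt ℂ f (Cover.proj p)) :
    xDeriv (fun q => f (Cover.proj q)) p = deriv f (Cover.proj p) := by
  have h : HasDerivAt (fun q : ℂ => f (Complex.exp q))
      (deriv f (Complex.exp p) * Complex.exp p) p :=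
    HasDerivAt.comp p hf.hasDerivAt (Complex.hasDerivAt_exp p)
  change deriv (fun q : ℂ => f (Complex.exp q)) p / Complex.exp p = deriv f (Complex.exp p)
  rw [h.deriv, mul_div_cancel_right₀ _ (Complex.exp_ne_zero p)]

/-- The potential `U(x; E, ℓ) = x ^ (2 α) + ℓ (ℓ + 1) / x ^ 2 - E`. -/
def potential (α : ℝ) (E l : ℂ) (p : Cover) : ℂ :=
  p.pow (2 * α) + l * (l + 1) / p.proj ^ 2 - E

/-- Solutions of `d²ψ/dx² = U(x; E, ℓ) ψ`: holomorphic functions on the whole cover. -/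
def IsSolution (α : ℝ) (E l : ℂ) (ψ : Cover → ℂ) : Prop :=
  Differentiable ℂ ψ ∧ ∀ p : Cover, xDeriv (xDeriv ψ) p = potential α E l p * ψ p

/-- The integer `⌊(1 + α) / (2 α)⌋`. -/
def truncation (α : ℝ) : ℕ := ⌊(1 + α) / (2 * α)⌋₊

/-- `d_α = α (1 + 2 ⌊(1 + α) / (2 α)⌋) - 1`. -/
def dExp (α : ℝ) : ℝ := α * (1 + 2 * (truncation α : ℝ)) - 1

/-- `e_α = min {d_α, α + 1}`. -/
def eExp (α : ℝ) : ℝ := min (dExp α) (α + 1)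

/-- The `k`-th coefficient of the Taylor series of `(1 - t) ^ (1/2)` at `t = 0`. -/
def sqrtCoeff (k : ℕ) : ℂ :=
  iteratedDeriv k (fun t : ℂ => (1 - t) ^ (1 / 2 : ℂ)) 0 / (Nat.factorial k : ℂ)

/-- The resonant values `α = 1 / (2 m - 1)`, `m = 1, 2, 3, …`. -/
def IsResonant (α : ℝ) : Prop := ∃ m : ℕ, 1 ≤ m ∧ α = 1 / (2 * (m : ℝ) - 1)

/-- At the resonant value `α = 1 / (2 m - 1)` the truncation index is `m`. -/
theorem truncation_of_resonant (m : ℕ) (hm : 1 ≤ m) :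
    truncation (1 / (2 * (m : ℝ) - 1)) = m := by
  have hm' : (1 : ℝ) ≤ (m : ℝ) := by exact_mod_cast hm
  have h : (2 * (m : ℝ) - 1) ≠ 0 := by linarith
  have : (1 + 1 / (2 * (m : ℝ) - 1)) / (2 * (1 / (2 * (m : ℝ) - 1))) = (m : ℝ) := by
    field_simp
    ring
  rw [truncation, this, Nat.floor_natCast]

/-- The `k`-th term `c_k E ^ k x ^ (α (1 - 2 k) + 1) / (α (1 - 2 k) + 1)`. -/
def actionTerm (α : ℝ) (E : ℂ) (p : Cover) (k : ℕ) : ℂ :=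
  sqrtCoeff k * E ^ k *
    (p.pow (α * (1 - 2 * (k : ℝ)) + 1) / ((α * (1 - 2 * (k : ℝ)) + 1 : ℝ) : ℂ))

open Classical in
/-- The truncated action `R(x)`. In the resonant case `α = 1 / (2 m - 1)` one has
`truncation α = m`, and the term of index `m` is replaced by `c_m E ^ m log x`. -/
def truncatedAction (α : ℝ) (E : ℂ) (p : Cover) : ℂ :=
  if IsResonant α then
    p.pow (α + 1) / ((α + 1 : ℝ) : ℂ)
      + ∑ k ∈ Finset.Ico 1 (truncation α), actionTerm α E p k
      + sqrtCoeff (truncation α) * E ^ truncation α * p.log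
  else
    p.pow (α + 1) / ((α + 1 : ℝ) : ℂ)
      + ∑ k ∈ Finset.Icc 1 (truncation α), actionTerm α E p k

/-- The closed subsector `|arg x - k π / (α + 1)| ≤ π / (2 α + 2) - ε` of the `k`-th Stokes
sector. -/
def closedSubsector (α : ℝ) (k : ℤ) (ε : ℝ) : Set Cover :=
  {p | |p.argument - (k : ℝ) * Real.pi / (α + 1)| ≤ Real.pi / (2 * α + 2) - ε}

/-- The estimate `|ψ(x) x ^ (α / 2) exp ((-1) ^ k R(x)) - 1| ≤ C |x| ^ (-e_α)` for all `x` in the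
closed subsector with `|x| ≥ M`. -/
def SibuyaBound (α : ℝ) (k : ℤ) (E : ℂ) (ψ : Cover → ℂ) (ε C M : ℝ) : Prop :=
  ∀ p ∈ closedSubsector α k ε, M ≤ p.modulus →
    ‖ψ p * p.pow (α / 2) * Complex.exp ((-1) ^ k * truncatedAction α E p) - 1‖
      ≤ C * p.modulus ^ (-eExp α)

/-- The normalised asymptotics `ψ(x) x ^ (α / 2) exp ((-1) ^ k R(x)) = 1 + O(|x| ^ (-e_α))` as
`x → ∞` in every closed subsector of the `k`-th Stokes sector, for one value of the parameters. -/
def HasSibuyaAsymptotics (α : ℝ) (k : ℤ) (E : ℂ) (ψ : Cover → ℂ) : Prop :=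
  ∀ ε : ℝ, 0 < ε → ∃ C M : ℝ, SibuyaBound α k E ψ ε C M

end AnharmonicOscillator

end

/-! In the coordinate `p = log x` equation (∗) becomes `ψ'' = ψ' + Q ψ` with `Q = x² U` entire in
`p`, `E`, `ℓ`, and radial rays become horizontal ones. Let `S` be the Taylor polynomial of degree
`N` of `(1 - t)^(1/2)` and `w = (-1)^k x^(α+1) S(E x^(-2α))`; the `p`-derivative of `(-1)^k R` is
`w`. Writing `ψ = x^(-α/2) exp(-(-1)^k R) z` turns the equation into `z'' = H' z' + V z` with `H' =
2w + α + 1`. Since `S² = 1 - t + O(t^(N+1))`, the defect `V` is `O(|x|^(α+1-e_α))`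
(`exists_norm_wkbDefect_le`).

Existence: inside the Stokes sector `Re H` grows along rays at a rate of order `|x|^(α+1)`
(`exists_re_phase_ge`). The integral equation `z = 1 + ∫ e^H ∫ e^(-H) V z` over rays therefore gains
a factor `O(|x|^(-e_α))` per iteration. Its Neumann series converges far out, depends
holomorphically on the parameters, and gives `z = 1 + O(|x|^(-e_α))`
(`KernelBound.exists_recessive`). The solution is continued to the whole cover by a fundamental
system jointly entire in `p` and the parameters (`exists_fundamental_system`).

Uniqueness: `e^(-p)` times the Wronskian of two such solutions is constant; on the central ray it is
`e^(-H)` times a bounded quantity, hence zero. The solutions are proportional, and the normalisation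
makes the factor `1` (`eq_of_sibuyaBound`). One subsector is enough for this, so the solutions built
for different `ε` and different parameter balls agree and glue into one entire family. -/

noncomputable section

open MeasureTheory Metric Set Filter Topology

namespace AnharmonicOscillator

/-! ### Holomorphy of dominated integrals and series. -/

section ParametricIntegral

variable {T : Type*} [MeasurableSpace T] {μ : Measure T}
  {X : Type*} [NormedAddCommGroup X] [NormedSpace ℂ X]
  {F : Type*} [NormedAddCommGroup F] [NormedSpace ℂ F]

/-- A map into the continuous linear maps on a finite dimensional space is measurable as soon as
its evaluations are. -/
theorem aestronglyMeasurable_of_apply [FiniteDimensional ℂ X] {Φ : T → X →L[ℂ] F}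
    (h : ∀ v, AEStronglyMeasurable (fun t => Φ t v) μ) : AEStronglyMeasurable Φ μ := by
  let b := Module.finBasis ℂ X
  have hΦ : Φ = fun t => ∑ i, ContinuousLinearMap.smulRightL ℂ X F
      (LinearMap.toContinuousLinearMap (b.coord i)) (Φ t (b i)) := by
    funext t
    ext v
    conv_lhs => rw [← b.sum_repr v]
    simp [map_sum, -Module.Basis.sum_repr]
  rw [hΦ]
  refine Finset.aestronglyMeasurable_fun_sum _ fun i _ => ?_
  exact (ContinuousLinearMap.continuous _).comp_aestronglyMeasurable (h (b i))

/-- The derivative of a map bounded on a ball is bounded on the ball of half the radius. -/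
theorem norm_fderiv_le_of_norm_le {f : X → F} {x₀ x : X} {r B : ℝ} (hr : 0 < r)
    (hf : DifferentiableOn ℂ f (ball x₀ r)) (hB : ∀ y ∈ ball x₀ r, ‖f y‖ ≤ B)
    (hx : x ∈ ball x₀ (r / 2)) : ‖fderiv ℂ f x‖ ≤ 4 / r * B := by
  have hsub : ball x (r / 2) ⊆ ball x₀ r := by
    intro y hy
    have h1 : dist y x < r / 2 := hy
    have h2 : dist x x₀ < r / 2 := hx
    have h3 := dist_triangle y x x₀
    rw [mem_ball]; linarith
  -- A Cauchy estimate: values stay within `2 * B` of `f x` on a ball of radius `r / 2`, and the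
  -- quotient is `4 / r * B`.
  have h := Complex.norm_fderiv_le_div_of_mapsTo_ball (R₂ := 2 * B) (hf.mono hsub) ?_
    (half_pos hr)
  · refine h.trans (le_of_eq ?_)
    field_simp
    ring
  · intro y hy
    have h1 := hB y (hsub hy)
    have h2 := hB x (hsub (mem_ball_self (half_pos hr)))
    rw [mem_closedBall, dist_eq_norm]
    linarith [norm_sub_le (f y) (f x)]

/-- Differentiation under the integral sign for dominated families of holomorphic maps. -/
theorem hasFDerivAt_integral_of_norm_le [FiniteDimensional ℂ X] {G : T → X → F} {x₀ : X}
    {r : ℝ} {b : T → ℝ} (hr : 0 < r)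
    (hmeas : ∀ x ∈ ball x₀ r, AEStronglyMeasurable (fun t => G t x) μ)
    (hdiff : ∀ᵐ t ∂μ, DifferentiableOn ℂ (G t) (ball x₀ r))
    (hbound : ∀ᵐ t ∂μ, ∀ x ∈ ball x₀ r, ‖G t x‖ ≤ b t) (hb : Integrable b μ) :
    Integrable (fun t => fderiv ℂ (G t) x₀) μ ∧
      HasFDerivAt (fun x => ∫ t, G t x ∂μ) (∫ t, fderiv ℂ (G t) x₀ ∂μ) x₀ := by
  have hx₀ := mem_ball_self (x := x₀) hr
  have hx₀' := mem_ball_self (x := x₀) (half_pos hr)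
  have hder : ∀ᵐ t ∂μ, ∀ x ∈ ball x₀ (r / 2), HasFDerivAt (G t) (fderiv ℂ (G t) x) x := by
    filter_upwards [hdiff] with t ht x hx
    exact (ht.differentiableAt (isOpen_ball.mem_nhds
      (ball_subset_ball (by linarith) hx))).hasFDerivAt
  have hle : ∀ᵐ t ∂μ, ∀ x ∈ ball x₀ (r / 2), ‖fderiv ℂ (G t) x‖ ≤ 4 / r * b t := by
    filter_upwards [hdiff, hbound] with t h1 h2 x hx
    exact norm_fderiv_le_of_norm_le hr h1 h2 hx
  -- The derivative is measurable as a pointwise limit of the difference quotients `n (G t (x₀ + v /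
  -- n) - G t x₀)`; the shift by `n₀` keeps `x₀ + v / n` in the ball.
  have hmeas' : AEStronglyMeasurable (fun t => fderiv ℂ (G t) x₀) μ := by
    refine aestronglyMeasurable_of_apply fun v => ?_
    have hc : Tendsto (fun n : ℕ => ‖(n : ℂ)‖) atTop atTop := by
      simpa using tendsto_natCast_atTop_atTop (R := ℝ)
    have hev : ∀ᶠ n : ℕ in atTop, x₀ + (n : ℂ)⁻¹ • v ∈ ball x₀ r := by
      have : Tendsto (fun n : ℕ => x₀ + (n : ℂ)⁻¹ • v) atTop (𝓝 (x₀ + (0 : ℂ) • v)) :=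
        ((tendsto_inv₀_cobounded.comp (tendsto_norm_atTop_iff_cobounded.1 hc)).smul_const
          v).const_add x₀
      rw [zero_smul, add_zero] at this
      exact this (ball_mem_nhds x₀ hr)
    obtain ⟨n₀, hn₀⟩ := eventually_atTop.1 hev
    refine aestronglyMeasurable_of_tendsto_ae atTop
      (f := fun n t => ((n + n₀ : ℕ) : ℂ) •
        (G t (x₀ + ((n + n₀ : ℕ) : ℂ)⁻¹ • v) - G t x₀)) (fun n => ?_) ?_
    · exact ((hmeas _ (hn₀ _ (Nat.le_add_left _ _))).sub (hmeas _ hx₀)).const_smul _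
    · filter_upwards [hder] with t ht
      exact ((ht x₀ hx₀').lim v hc).comp (tendsto_add_atTop_nat n₀)
  have hint : Integrable (fun t => G t x₀) μ :=
    hb.mono' (hmeas _ hx₀) (hbound.mono fun t ht => ht x₀ hx₀)
  refine ⟨(hb.const_mul (4 / r)).mono' hmeas' (hle.mono fun t ht => ht x₀ hx₀'), ?_⟩
  refine hasFDerivAt_integral_of_dominated_of_fderiv_le (F' := fun x t => fderiv ℂ (G t) x)
    (ball_mem_nhds x₀ (half_pos hr)) ?_ hint hmeas' hle (hb.const_mul (4 / r)) hder
  filter_upwards [ball_mem_nhds x₀ hr] with x hx using hmeas x hx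

/-- Locally uniformly summable series of holomorphic maps are holomorphic. -/
theorem differentiableOn_tsum_of_locally_summable [CompleteSpace F] {f : ℕ → X → F}
    {Ω : Set X} (hΩ : IsOpen Ω)
    (hf : ∀ n, DifferentiableOn ℂ (f n) Ω)
    (hs : ∀ x ∈ Ω, ∃ b : ℕ → ℝ, Summable b ∧ ∀ᶠ y in 𝓝 x, ∀ n, ‖f n y‖ ≤ b n) :
    DifferentiableOn ℂ (fun x => ∑' n, f n x) Ω := by
  intro x hx
  obtain ⟨b, hb, hle⟩ := hs x hx
  obtain ⟨r, hr, hsub⟩ := Metric.mem_nhds_iff.1 (inter_mem hle (hΩ.mem_nhds hx))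
  have hball : ball x (r / 2) ⊆ ball x r := ball_subset_ball (by linarith)
  have hx' := mem_ball_self (x := x) (half_pos hr)
  refine (hasFDerivAt_tsum_of_isPreconnected (u := fun n => 4 / r * b n) (hb.mul_left _)
    isOpen_ball (convex_ball x (r / 2)).isPreconnected
    (f' := fun n y => fderiv ℂ (f n) y) (fun n y hy => ?_) (fun n y hy => ?_) hx' ?_
    hx').differentiableAt.differentiableWithinAt
  · exact ((hf n).differentiableAt (hΩ.mem_nhds (hsub (hball hy)).2)).hasFDerivAt
  · exact norm_fderiv_le_of_norm_le hr ((hf n).mono fun z hz => (hsub hz).2)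
      (fun z hz => (hsub hz).1 n) hy
  · exact hb.of_norm_bounded fun n => (hsub (hball hx')).1 n

end ParametricIntegral

/-! ### Linear equations with entire coefficients and parameters. -/

section LinearODE

variable {P : Type*} {F : Type*} [NormedAddCommGroup F] [NormedSpace ℂ F]

/-- The primitive `∫ f(q, ξ) dq` along the segment from `p₀` to `p`. -/
def segmentIntegral (p₀ : ℂ) (f : ℂ × P → F) (x : ℂ × P) : F :=
  ∫ t in (0 : ℝ)..1, (x.1 - p₀) • f (p₀ + t * (x.1 - p₀), x.2)

theorem segmentIntegral_hasDerivAt [NormedAddCommGroup P] [NormedSpace ℂ P]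
    [FiniteDimensional ℂ P] [CompleteSpace F] (p₀ : ℂ)
    {f : ℂ × P → F} (hf : Differentiable ℂ f) :
    Differentiable ℂ (segmentIntegral p₀ f) ∧
      ∀ p ξ, HasDerivAt (fun q => segmentIntegral p₀ f (q, ξ)) (f (p, ξ)) p := by
  have : ProperSpace P := FiniteDimensional.proper ℂ P
  let G : ℝ → ℂ × P → F := fun t x => (x.1 - p₀) • f (p₀ + t * (x.1 - p₀), x.2)
  have hG : Continuous fun y : ℝ × (ℂ × P) => G y.1 y.2 := by
    have := hf.continuous
    fun_prop
  have hGd : ∀ t, Differentiable ℂ (G t) := fun t => by fun_prop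
  have key : ∀ x, Integrable (fun t => fderiv ℂ (G t) x) (volume.restrict (Ioc (0 : ℝ) 1)) ∧
      HasFDerivAt (segmentIntegral p₀ f)
        (∫ t, fderiv ℂ (G t) x ∂(volume.restrict (Ioc (0 : ℝ) 1))) x := by
    intro x
    obtain ⟨K, hK⟩ := ((isCompact_Icc (a := (0 : ℝ)) (b := 1)).prod
      (isCompact_closedBall x 1)).exists_bound_of_continuousOn hG.continuousOn
    have h := hasFDerivAt_integral_of_norm_le (μ := volume.restrict (Ioc (0 : ℝ) 1)) (G := G)
      (x₀ := x) (b := fun _ => K) one_pos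
      (fun y _ => (show Continuous fun t => G t y by fun_prop).aestronglyMeasurable)
      (ae_of_all _ fun t => (hGd t).differentiableOn)
      ((ae_restrict_iff' measurableSet_Ioc).2 (ae_of_all _ fun t ht y hy =>
        hK (t, y) ⟨⟨ht.1.le, ht.2⟩, ball_subset_closedBall hy⟩)) (integrable_const _)
    refine ⟨h.1, h.2.congr_of_eventuallyEq (Eventually.of_forall fun y => ?_)⟩
    simp only [segmentIntegral, intervalIntegral.integral_of_le zero_le_one, G]
  refine ⟨fun x => (key x).2.differentiableAt, fun p ξ => ?_⟩
  obtain ⟨hint, hder⟩ := key (p, ξ)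
  have h1 : HasDerivAt (fun q : ℂ => (q, ξ)) ((1 : ℂ), (0 : P)) p :=
    (hasDerivAt_id p).prodMk (hasDerivAt_const p ξ)
  have h2 := hder.comp_hasDerivAt p h1
  rw [ContinuousLinearMap.integral_apply hint] at h2
  -- The `p`-derivative of the integrand is the `t`-derivative of `t f(p₀ + t (p - p₀), ξ)`, so its
  -- integral over `[0, 1]` is `f (p, ξ)`.
  have h3 : ∀ t : ℝ, HasDerivAt (fun t : ℝ => (t : ℂ) • f (p₀ + t * (p - p₀), ξ))
      (fderiv ℂ (G t) (p, ξ) (1, 0)) t := by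
    intro t
    have hf' := (hf (p₀ + t * (p - p₀), ξ)).hasFDerivAt
    have e1 : HasDerivAt (fun s : ℝ => (p₀ + s * (p - p₀), ξ)) (p - p₀, (0 : P)) t := by
      refine HasDerivAt.prodMk ?_ (hasDerivAt_const t ξ)
      simpa using ((Complex.ofRealCLM.hasDerivAt (x := t)).mul_const (p - p₀)).const_add p₀
    have e2 := (Complex.ofRealCLM.hasDerivAt (x := t)).smul
      ((hf'.restrictScalars ℝ).comp_hasDerivAt t e1)
    have e3 : HasDerivAt (fun q : ℂ => (p₀ + t * (q - p₀), ξ)) ((t : ℂ), (0 : P)) p := by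
      refine HasDerivAt.prodMk ?_ (hasDerivAt_const p ξ)
      simpa using (((hasDerivAt_id p).sub_const p₀).const_mul (t : ℂ)).const_add p₀
    have e4 := ((hasDerivAt_id p).sub_const p₀).smul
      (HasFDerivAt.comp_hasDerivAt p (l := f) (f := fun q : ℂ => (p₀ + t * (q - p₀), ξ)) hf' e3)
    have e5 := ((hGd t) (p, ξ)).hasFDerivAt.comp_hasDerivAt p h1
    have e6 := e5.unique e4
    rw [e6]
    refine e2.congr_deriv ?_
    have a1 : ((t : ℂ), (0 : P)) = (t : ℂ) • ((1 : ℂ), (0 : P)) := by simp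
    have a2 : (p - p₀, (0 : P)) = (p - p₀) • ((1 : ℂ), (0 : P)) := by simp
    change (t : ℂ) • fderiv ℂ f (p₀ + t * (p - p₀), ξ) (p - p₀, 0)
      + ((1 : ℝ) : ℂ) • f (p₀ + t * (p - p₀), ξ) =
      (p - p₀) • fderiv ℂ f (p₀ + t * (p - p₀), ξ) (t, 0) + (1 : ℂ) • f (p₀ + t * (p - p₀), ξ)
    rw [a1, a2, map_smul, map_smul, smul_smul, smul_smul, mul_comm, Complex.ofReal_one]
  have h4 := intervalIntegral.integral_eq_sub_of_hasDerivAt (a := 0) (b := 1)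
    (fun t _ => h3 t) ?_
  · rw [intervalIntegral.integral_of_le zero_le_one] at h4
    rw [h4] at h2
    simpa [Function.comp_def] using h2
  · rw [intervalIntegrable_iff_integrableOn_Ioc_of_le zero_le_one]
    exact hint.apply_continuousLinearMap _

/-- The terms of the Neumann series of a linear equation. -/
def neumannTerm (p₀ : ℂ) (A : ℂ × P → F →L[ℂ] F) (y₀ : F) : ℕ → ℂ × P → F
  | 0 => fun _ => y₀
  | n + 1 => segmentIntegral p₀ fun x => A x (neumannTerm p₀ A y₀ n x)

/-- Picard's estimate: integrating `t ^ n` along the segment supplies the factor `1 / (n + 1)` that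
builds the factorial. -/
theorem norm_neumannTerm_le {p₀ : ℂ} {A : ℂ × P → F →L[ℂ] F} {y₀ : F} {ρ K : ℝ} {ξ : P}
    (hK : ∀ p ∈ closedBall p₀ ρ, ‖A (p, ξ)‖ ≤ K) (n : ℕ) :
    ∀ p ∈ closedBall p₀ ρ,
      ‖neumannTerm p₀ A y₀ n (p, ξ)‖ ≤ ‖y₀‖ * ((K * ‖p - p₀‖) ^ n / n.factorial) := by
  induction n with
  | zero => intro p _; simp [neumannTerm]
  | succ n ih =>
    intro p hp
    have hK0 : 0 ≤ K := (norm_nonneg _).trans (hK p hp)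
    rw [mem_closedBall, dist_eq_norm] at hp
    rw [neumannTerm, segmentIntegral]
    have hle : ∀ t ∈ Ioc (0 : ℝ) 1, ‖(p - p₀) • A (p₀ + t * (p - p₀), ξ)
        (neumannTerm p₀ A y₀ n (p₀ + t * (p - p₀), ξ))‖ ≤
        ‖y₀‖ * ((K * ‖p - p₀‖) ^ (n + 1) / n.factorial) * t ^ n := by
      intro t ht
      have hn : ‖p₀ + t * (p - p₀) - p₀‖ = t * ‖p - p₀‖ := by
        rw [add_sub_cancel_left, norm_mul, Complex.norm_real, Real.norm_of_nonneg ht.1.le]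
      have hmem : p₀ + t * (p - p₀) ∈ closedBall p₀ ρ := by
        rw [mem_closedBall, dist_eq_norm, hn]
        exact (mul_le_of_le_one_left (norm_nonneg _) ht.2).trans hp
      have h1 := ih _ hmem
      rw [hn] at h1
      rw [norm_smul]
      calc _ ≤ ‖p - p₀‖ * (K * (‖y₀‖ * ((K * (t * ‖p - p₀‖)) ^ n / n.factorial))) := by
            gcongr
            exact (ContinuousLinearMap.le_opNorm _ _).trans
              (mul_le_mul (hK _ hmem) h1 (norm_nonneg _) hK0)
        _ = _ := by ring
    refine (intervalIntegral.norm_integral_le_of_norm_le zero_le_one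
      (g := fun t => ‖y₀‖ * ((K * ‖p - p₀‖) ^ (n + 1) / n.factorial) * t ^ n)
      (ae_of_all _ hle) (Continuous.intervalIntegrable (by fun_prop) _ _)).trans (le_of_eq ?_)
    rw [intervalIntegral.integral_const_mul, integral_pow, Nat.factorial_succ]
    push_cast
    field_simp
    simp

/-- A linear equation with entire coefficients that are entire in a parameter has solutions that
are jointly entire. -/
theorem exists_entire_solution [NormedAddCommGroup P] [NormedSpace ℂ P]
    [FiniteDimensional ℂ P] [CompleteSpace F] (p₀ : ℂ)
    {A : ℂ × P → F →L[ℂ] F} (hA : Differentiable ℂ A) (y₀ : F) :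
    ∃ Y : ℂ × P → F, Differentiable ℂ Y ∧ (∀ ξ, Y (p₀, ξ) = y₀) ∧
      ∀ p ξ, HasDerivAt (fun q => Y (q, ξ)) (A (p, ξ) (Y (p, ξ))) p := by
  have : ProperSpace P := FiniteDimensional.proper ℂ P
  let y := neumannTerm p₀ A y₀
  have hd : ∀ n, Differentiable ℂ (y n) := by
    intro n
    induction n with
    | zero => exact differentiable_const y₀
    | succ n ih => exact (segmentIntegral_hasDerivAt p₀ (hA.clm_apply ih)).1
  have hder : ∀ n p ξ, HasDerivAt (fun q => y (n + 1) (q, ξ)) (A (p, ξ) (y n (p, ξ))) p :=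
    fun n p ξ => (segmentIntegral_hasDerivAt p₀ (hA.clm_apply (hd n))).2 p ξ
  have hbound : ∀ x : ℂ × P, ∃ K R : ℝ, ∀ z ∈ ball x 1, ‖A z‖ ≤ K ∧
      ∀ n, ‖y n z‖ ≤ ‖y₀‖ * ((K * R) ^ n / n.factorial) := by
    intro x
    let ρ : ℝ := dist x.1 p₀ + 1
    obtain ⟨K, hK⟩ := ((isCompact_closedBall p₀ ρ).prod
      (isCompact_closedBall x.2 1)).exists_bound_of_continuousOn hA.continuous.continuousOn
    refine ⟨K, ρ, fun z hz => ?_⟩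
    have hz' : dist z.1 x.1 < 1 ∧ dist z.2 x.2 < 1 := by
      simpa [Prod.dist_eq, mem_ball] using hz
    have hz1 : z.1 ∈ closedBall p₀ ρ := by
      have := dist_triangle z.1 x.1 p₀
      rw [mem_closedBall]
      linarith
    have hz2 : z.2 ∈ closedBall x.2 1 := hz'.2.le
    refine ⟨hK z ⟨hz1, hz2⟩, fun n => ?_⟩
    refine (norm_neumannTerm_le (fun p hp => hK (p, z.2) ⟨hp, hz2⟩) n z.1 hz1).trans ?_
    have : 0 ≤ K := (norm_nonneg _).trans (hK z ⟨hz1, hz2⟩)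
    rw [mem_closedBall, dist_eq_norm] at hz1
    gcongr
  have hsum : ∀ K R : ℝ, Summable fun n : ℕ => ‖y₀‖ * ((K * R) ^ n / n.factorial) :=
    fun K R => (Real.summable_pow_div_factorial _).mul_left _
  refine ⟨fun x => ∑' n, y n x, ?_, fun ξ => ?_, fun p ξ => ?_⟩
  · rw [← differentiableOn_univ]
    refine differentiableOn_tsum_of_locally_summable isOpen_univ
      (fun n => (hd n).differentiableOn) fun x _ => ?_
    obtain ⟨K, R, h⟩ := hbound x
    exact ⟨_, hsum K R, by filter_upwards [ball_mem_nhds x one_pos] with z hz using (h z hz).2⟩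
  · change ∑' n, y n (p₀, ξ) = y₀
    rw [tsum_eq_single 0]
    · rfl
    · rintro (_ | n) hn
      · exact absurd rfl hn
      · simp [y, neumannTerm, segmentIntegral]
  · obtain ⟨K, R, h⟩ := hbound (p, ξ)
    have hmem : ∀ q ∈ ball p 1, (q, ξ) ∈ ball (p, ξ) 1 := by
      intro q hq
      simpa [Prod.dist_eq, mem_ball] using hq
    have hs : ∀ q ∈ ball p 1, Summable fun n => y n (q, ξ) := fun q hq =>
      (hsum K R).of_norm_bounded (h _ (hmem q hq)).2
    have hp := mem_ball_self (x := p) one_pos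
    -- The constant term is split off because only the later terms are primitives; term `n + 1`
    -- differentiates to `A` applied to term `n`.
    have hsplit : ∀ q ∈ ball p 1, ∑' n, y n (q, ξ) = y₀ + ∑' n, y (n + 1) (q, ξ) :=
      fun q hq => (hs q hq).tsum_eq_zero_add
    have h1 := hasDerivAt_tsum_of_isPreconnected (𝕜 := ℂ) (t := ball p 1) (y₀ := p) (y := p)
      (u := fun n => K * (‖y₀‖ * ((K * R) ^ n / n.factorial)))
      (g := fun n q => y (n + 1) (q, ξ)) (g' := fun n q => A (q, ξ) (y n (q, ξ)))
      ((hsum K R).mul_left K) isOpen_ball (convex_ball p 1).isPreconnected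
      (fun n q _ => hder n q ξ) (fun n q hq => ?_) hp ((summable_nat_add_iff 1).2 (hs p hp)) hp
    · have h2 := h1.const_add y₀
      rw [← ContinuousLinearMap.map_tsum _ (hs p hp)] at h2
      refine h2.congr_of_eventuallyEq ?_
      filter_upwards [ball_mem_nhds p one_pos] with q hq using hsplit q hq
    · obtain ⟨hA', hy⟩ := h _ (hmem q hq)
      exact (ContinuousLinearMap.le_opNorm _ _).trans
        (mul_le_mul hA' (hy n) (norm_nonneg _) ((norm_nonneg _).trans hA'))

end LinearODE

/-! ### Integrals along horizontal rays. -/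

section Ray

variable {P : Type*}

/-- The integral of `f` along the horizontal ray from `p` to `+∞`. -/
def rayIntegral (f : ℂ × P → ℂ) (x : ℂ × P) : ℂ := ∫ t in Ioi (0 : ℝ), f (x.1 + t, x.2)

/-- A set is forward invariant when it contains the horizontal rays issued from its points. -/
def ForwardInvariant (Ω : Set (ℂ × P)) : Prop :=
  ∀ x ∈ Ω, ∀ t : ℝ, 0 ≤ t → (x.1 + t, x.2) ∈ Ω

/-- Exponential decay along horizontal rays, locally uniform in the initial point. -/
def LocallyDecays [TopologicalSpace P] (Ω : Set (ℂ × P)) (f : ℂ × P → ℂ) : Prop :=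
  ∀ x ∈ Ω, ∃ K δ : ℝ, 0 < δ ∧ ∀ᶠ y in 𝓝 x, ∀ t : ℝ, 0 ≤ t →
    ‖f (y.1 + t, y.2)‖ ≤ K * Real.exp (-δ * t)

theorem integrableOn_const_mul_exp_neg (K : ℝ) {δ : ℝ} (hδ : 0 < δ) :
    IntegrableOn (fun t => K * Real.exp (-δ * t)) (Ioi 0) :=
  (exp_neg_integrableOn_Ioi 0 hδ).const_mul K

theorem integral_const_mul_exp_neg (K : ℝ) {δ : ℝ} (hδ : 0 < δ) :
    ∫ t in Ioi (0 : ℝ), K * Real.exp (-δ * t) = K / δ := by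
  rw [integral_const_mul, integral_exp_mul_Ioi (neg_neg_of_pos hδ)]
  simp [div_eq_mul_inv]

theorem norm_setIntegral_Ioi_le {f : ℝ → ℂ} {K δ : ℝ} (hδ : 0 < δ)
    (h : ∀ t : ℝ, 0 ≤ t → ‖f t‖ ≤ K * Real.exp (-δ * t)) : ‖∫ t in Ioi (0 : ℝ), f t‖ ≤ K / δ := by
  rw [← integral_const_mul_exp_neg K hδ]
  exact norm_integral_le_of_norm_le (integrableOn_const_mul_exp_neg K hδ)
    ((ae_restrict_iff' measurableSet_Ioi).2 (ae_of_all _ fun t ht => h t (le_of_lt ht)))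

theorem tendsto_const_mul_exp_neg (K : ℝ) {δ : ℝ} (hδ : 0 < δ) :
    Tendsto (fun t => K * Real.exp (-δ * t)) atTop (𝓝 0) := by
  have h : Tendsto (fun t : ℝ => -δ * t) atTop atBot :=
    tendsto_id.const_mul_atTop_of_neg (neg_neg_of_pos hδ)
  simpa using (Real.tendsto_exp_atBot.comp h).const_mul K

variable [NormedAddCommGroup P] [NormedSpace ℂ P]

/-- Translating the ray differentiates the integrand in `t`, so the integral of the derivative
telescopes to `0 - f x`. The decay hypothesis supplies both the domination and the zero limit at
infinity. -/
theorem rayIntegral_hasDerivAt [FiniteDimensional ℂ P] {Ω : Set (ℂ × P)} (hΩ : IsOpen Ω)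
    (hinv : ForwardInvariant Ω) {f : ℂ × P → ℂ} (hf : DifferentiableOn ℂ f Ω)
    (hdec : LocallyDecays Ω f) :
    DifferentiableOn ℂ (rayIntegral f) Ω ∧
      ∀ x ∈ Ω, HasDerivAt (fun q => rayIntegral f (q, x.2)) (-f x) x.1 := by
  let G : ℝ → ℂ × P → ℂ := fun t x => f (x.1 + t, x.2)
  have hGd : ∀ t : ℝ, 0 ≤ t → DifferentiableOn ℂ (G t) Ω := fun t ht =>
    hf.comp (Differentiable.differentiableOn (by fun_prop)) fun x hx => hinv x hx t ht
  have hray : ∀ x ∈ Ω, ContinuousOn (fun t : ℝ => G t x) (Ici 0) := fun x hx =>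
    hf.continuousOn.comp (Continuous.continuousOn (by fun_prop)) fun t ht => hinv x hx t ht
  have key : ∀ x ∈ Ω, Integrable (fun t => fderiv ℂ (G t) x) (volume.restrict (Ioi (0 : ℝ))) ∧
      HasFDerivAt (rayIntegral f)
        (∫ t, fderiv ℂ (G t) x ∂(volume.restrict (Ioi (0 : ℝ)))) x := by
    intro x hx
    obtain ⟨K, δ, hδ, hle⟩ := hdec x hx
    obtain ⟨r, hr, hsub⟩ := Metric.mem_nhds_iff.1 (inter_mem hle (hΩ.mem_nhds hx))
    exact hasFDerivAt_integral_of_norm_le (μ := volume.restrict (Ioi (0 : ℝ))) (G := G) hr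
      (fun y hy => ((hray y (hsub hy).2).mono Ioi_subset_Ici_self).aestronglyMeasurable
        measurableSet_Ioi)
      ((ae_restrict_iff' measurableSet_Ioi).2 (ae_of_all _ fun t ht =>
        (hGd t (le_of_lt ht)).mono fun y hy => (hsub hy).2))
      ((ae_restrict_iff' measurableSet_Ioi).2 (ae_of_all _ fun t ht y hy =>
        (hsub hy).1 t (le_of_lt ht))) (integrableOn_const_mul_exp_neg K hδ)
  refine ⟨fun x hx => (key x hx).2.differentiableAt.differentiableWithinAt, fun x hx => ?_⟩
  obtain ⟨hint, hder⟩ := key x hx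
  have h1 : HasDerivAt (fun q : ℂ => (q, x.2)) ((1 : ℂ), (0 : P)) x.1 :=
    (hasDerivAt_id x.1).prodMk (hasDerivAt_const x.1 x.2)
  have h2 := HasFDerivAt.comp_hasDerivAt x.1 (l := rayIntegral f)
    (f := fun q : ℂ => (q, x.2)) hder h1
  rw [ContinuousLinearMap.integral_apply hint] at h2
  have h3 : ∀ t ∈ Ici (0 : ℝ), HasDerivAt (fun t : ℝ => f (x.1 + t, x.2))
      (fderiv ℂ (G t) x (1, 0)) t := by
    intro t ht
    have hf' := (hf.differentiableAt (hΩ.mem_nhds (hinv x hx t ht))).hasFDerivAt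
    have e1 : HasDerivAt (fun s : ℝ => (x.1 + (s : ℂ), x.2)) ((1 : ℂ), (0 : P)) t := by
      refine HasDerivAt.prodMk ?_ (hasDerivAt_const t x.2)
      simpa using (Complex.ofRealCLM.hasDerivAt (x := t)).const_add x.1
    have e2 := HasFDerivAt.comp_hasDerivAt t (l := f) (f := fun s : ℝ => (x.1 + (s : ℂ), x.2))
      (hf'.restrictScalars ℝ) e1
    have e3 : HasDerivAt (fun q : ℂ => (q + (t : ℂ), x.2)) ((1 : ℂ), (0 : P)) x.1 :=
      ((hasDerivAt_id x.1).add_const (t : ℂ)).prodMk (hasDerivAt_const x.1 x.2)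
    have e4 := HasFDerivAt.comp_hasDerivAt x.1 (l := f) (f := fun q : ℂ => (q + (t : ℂ), x.2))
      hf' e3
    have e5 := HasFDerivAt.comp_hasDerivAt x.1 (l := G t) (f := fun q : ℂ => (q, x.2))
      ((hGd t ht).differentiableAt (hΩ.mem_nhds hx)).hasFDerivAt h1
    rw [e5.unique e4]
    exact e2
  have hlim : Tendsto (fun t : ℝ => f (x.1 + t, x.2)) atTop (𝓝 0) := by
    obtain ⟨K, δ, hδ, hle⟩ := hdec x hx
    refine squeeze_zero_norm' ?_ (tendsto_const_mul_exp_neg K hδ)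
    filter_upwards [eventually_ge_atTop 0] with t ht using hle.self_of_nhds t ht
  rw [integral_Ioi_of_hasDerivAt_of_tendsto' h3 (hint.apply_continuousLinearMap _) hlim] at h2
  simpa [Function.comp_def] using h2

end Ray

/-! ### The recessive solution of the amplitude equation. -/

section Recessive

variable {P : Type*}

/-- The solution `exp H ∫ exp (-H) V f` of `J' = H' J - V f` that is recessive along rays. -/
def recessiveIntegral (H V f : ℂ × P → ℂ) (x : ℂ × P) : ℂ :=
  Complex.exp (H x) * rayIntegral (fun y => Complex.exp (-H y) * V y * f y) x

/-- The terms of the Neumann series for the recessive solution of `z'' = H' z' + V z`. -/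
def recessiveTerm (H V : ℂ × P → ℂ) : ℕ → ℂ × P → ℂ
  | 0 => fun _ => 1
  | n + 1 => rayIntegral (recessiveIntegral H V (recessiveTerm H V n))

variable [NormedAddCommGroup P] [NormedSpace ℂ P]

/-- The kernel estimate that makes the Neumann series converge on `Ω`. -/
structure KernelBound (Ω : Set (ℂ × P)) (H H' V : ℂ × P → ℂ) (β : ℂ × P → ℝ) (A e : ℝ) :
    Prop where
  isOpen : IsOpen Ω
  invariant : ForwardInvariant Ω
  differentiableOn_H : DifferentiableOn ℂ H Ω
  hasDerivAt_H : ∀ x ∈ Ω, HasDerivAt (fun q => H (q, x.2)) (H' x) x.1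
  continuousOn_H' : ContinuousOn H' Ω
  differentiableOn_V : DifferentiableOn ℂ V Ω
  continuousOn_β : ContinuousOn β Ω
  β_pos : ∀ x ∈ Ω, 0 < β x
  A_nonneg : 0 ≤ A
  e_pos : 0 < e
  norm_le : ∀ x ∈ Ω, ∀ t : ℝ, 0 ≤ t →
    ‖Complex.exp (H x - H (x.1 + t, x.2)) * V (x.1 + t, x.2)‖ ≤
      A * Real.exp (-e * x.1.re) * (β x * Real.exp (-β x * t))
  small : ∀ x ∈ Ω, A / e * Real.exp (-e * x.1.re) ≤ 1 / 2

namespace KernelBound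

variable {Ω : Set (ℂ × P)} {H H' V : ℂ × P → ℂ} {β : ℂ × P → ℝ} {A e : ℝ}

/-- The kernel factor `β exp (-β t)` has total mass one, so the decay rate `β` disappears from the
bound. -/
theorem norm_recessiveIntegral_le (h : KernelBound Ω H H' V β A e) {f : ℂ × P → ℂ} {B : ℝ}
    (hB : ∀ x ∈ Ω, ‖f x‖ ≤ B) {x : ℂ × P} (hx : x ∈ Ω) :
    ‖recessiveIntegral H V f x‖ ≤ A * B * Real.exp (-e * x.1.re) := by
  rw [recessiveIntegral, rayIntegral, ← integral_const_mul]
  have hβ := h.β_pos x hx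
  refine (norm_setIntegral_Ioi_le (K := A * Real.exp (-e * x.1.re) * β x * B) hβ
    fun t ht => ?_).trans (le_of_eq (by field_simp))
  have e1 : Complex.exp (H x) * (Complex.exp (-H (x.1 + t, x.2)) * V (x.1 + t, x.2) *
      f (x.1 + t, x.2)) = Complex.exp (H x - H (x.1 + t, x.2)) * V (x.1 + t, x.2) *
      f (x.1 + t, x.2) := by
    rw [sub_eq_add_neg, Complex.exp_add]
    ring
  rw [e1, norm_mul]
  calc _ ≤ A * Real.exp (-e * x.1.re) * (β x * Real.exp (-β x * t)) * B :=
        mul_le_mul (h.norm_le x hx t ht) (hB _ (h.invariant x hx t ht)) (norm_nonneg _)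
          ((norm_nonneg _).trans (h.norm_le x hx t ht))
    _ = _ := by ring

theorem locallyDecays_integrand (h : KernelBound Ω H H' V β A e) {f : ℂ × P → ℂ} {B : ℝ}
    (hB : ∀ x ∈ Ω, ‖f x‖ ≤ B) :
    LocallyDecays Ω fun y => Complex.exp (-H y) * V y * f y := by
  intro x hx
  have hΩx := h.isOpen.mem_nhds hx
  have hβ := h.β_pos x hx
  have hB0 : 0 ≤ B := (norm_nonneg _).trans (hB x hx)
  let c : ℂ × P → ℝ := fun y =>
    ‖Complex.exp (-H y)‖ * (A * Real.exp (-e * y.1.re) * β y * B)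
  have hc : ContinuousOn c Ω := by
    have h1 := h.differentiableOn_H.continuousOn
    have h2 := h.continuousOn_β
    fun_prop
  -- By continuity, near `x` the prefactor stays below `c x + 1` and the rate stays above `β x / 2`.
  refine ⟨c x + 1, β x / 2, half_pos hβ, ?_⟩
  filter_upwards [hΩx, (hc.continuousAt hΩx).eventually (gt_mem_nhds (lt_add_one (c x))),
    (h.continuousOn_β.continuousAt hΩx).eventually (lt_mem_nhds (half_lt_self hβ))]
    with y hy hcy hβy t ht
  have e1 : Complex.exp (-H (y.1 + t, y.2)) = Complex.exp (-H y) *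
      Complex.exp (H y - H (y.1 + t, y.2)) := by
    rw [← Complex.exp_add]
    ring_nf
  rw [e1, mul_assoc (Complex.exp (-H y)), norm_mul, norm_mul]
  have e2 : Real.exp (-β y * t) ≤ Real.exp (-(β x / 2) * t) := by
    apply Real.exp_le_exp.2
    nlinarith
  have hc0 : 0 ≤ c y := by
    have := h.A_nonneg
    have := (h.β_pos y hy).le
    positivity
  calc _ ≤ ‖Complex.exp (-H y)‖ * (A * Real.exp (-e * y.1.re) *
          (β y * Real.exp (-β y * t))) * B :=
        mul_le_mul (mul_le_mul_of_nonneg_left (h.norm_le y hy t ht) (norm_nonneg _))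
          (hB _ (h.invariant y hy t ht)) (norm_nonneg _)
          (mul_nonneg (norm_nonneg _) ((norm_nonneg _).trans (h.norm_le y hy t ht)))
    _ = c y * Real.exp (-β y * t) := by ring
    _ ≤ _ := mul_le_mul hcy.le e2 (Real.exp_pos _).le (hc0.trans hcy.le)

/-- The decay comes from the factor `exp (-e * re p)`, which the first integration leaves; it allows
the second integration over the ray. -/
theorem locallyDecays_recessiveIntegral (h : KernelBound Ω H H' V β A e) {f : ℂ × P → ℂ} {B : ℝ}
    (hB : ∀ x ∈ Ω, ‖f x‖ ≤ B) : LocallyDecays Ω (recessiveIntegral H V f) := by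
  intro x hx
  have hΩx := h.isOpen.mem_nhds hx
  let c : ℂ × P → ℝ := fun y => A * B * Real.exp (-e * y.1.re)
  have hc : Continuous c := by fun_prop
  refine ⟨c x + 1, e, h.e_pos, ?_⟩
  filter_upwards [hΩx, hc.continuousAt.eventually (gt_mem_nhds (lt_add_one (c x)))]
    with y hy hcy t ht
  refine (h.norm_recessiveIntegral_le hB (h.invariant y hy t ht)).trans ?_
  have e1 : A * B * Real.exp (-e * (y.1 + (t : ℂ)).re) = c y * Real.exp (-e * t) := by
    rw [Complex.add_re, Complex.ofReal_re, mul_add, Real.exp_add]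
    ring
  rw [e1]
  exact mul_le_mul_of_nonneg_right hcy.le (Real.exp_pos _).le

theorem recessiveIntegral_hasDerivAt [FiniteDimensional ℂ P] (h : KernelBound Ω H H' V β A e)
    {f : ℂ × P → ℂ} {B : ℝ} (hf : DifferentiableOn ℂ f Ω) (hB : ∀ x ∈ Ω, ‖f x‖ ≤ B) :
    DifferentiableOn ℂ (recessiveIntegral H V f) Ω ∧
      ∀ x ∈ Ω, HasDerivAt (fun q => recessiveIntegral H V f (q, x.2))
        (H' x * recessiveIntegral H V f x - V x * f x) x.1 := by
  have hd : DifferentiableOn ℂ (fun y => Complex.exp (-H y) * V y * f y) Ω :=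
    (h.differentiableOn_H.neg.cexp.mul h.differentiableOn_V).mul hf
  obtain ⟨h1, h2⟩ := rayIntegral_hasDerivAt h.isOpen h.invariant hd (h.locallyDecays_integrand hB)
  refine ⟨h.differentiableOn_H.cexp.mul h1, fun x hx => ?_⟩
  refine ((h.hasDerivAt_H x hx).cexp.mul (h2 x hx)).congr_deriv ?_
  have e1 : Complex.exp (H x) * Complex.exp (-H x) = 1 := by
    rw [← Complex.exp_add, add_neg_cancel, Complex.exp_zero]
  simp only [recessiveIntegral, Prod.mk.eta]
  linear_combination (-V x * f x) * e1

/-- One full iteration: the outer integral of `exp (-e * re p)` costs `1 / e`, and `small` makes the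
resulting factor at most `1 / 2`. -/
theorem norm_rayIntegral_recessiveIntegral_le (h : KernelBound Ω H H' V β A e) {f : ℂ × P → ℂ}
    {B : ℝ} (hB : ∀ x ∈ Ω, ‖f x‖ ≤ B) {x : ℂ × P} (hx : x ∈ Ω) :
    ‖rayIntegral (recessiveIntegral H V f) x‖ ≤ A / e * Real.exp (-e * x.1.re) * B := by
  refine (norm_setIntegral_Ioi_le (K := A * B * Real.exp (-e * x.1.re)) h.e_pos
    fun t ht => ?_).trans (le_of_eq (by ring))
  refine (h.norm_recessiveIntegral_le hB (h.invariant x hx t ht)).trans (le_of_eq ?_)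
  rw [Complex.add_re, Complex.ofReal_re, mul_add, Real.exp_add]
  ring

theorem recessiveTerm_spec [FiniteDimensional ℂ P] (h : KernelBound Ω H H' V β A e) (n : ℕ) :
    DifferentiableOn ℂ (recessiveTerm H V n) Ω ∧
      ∀ x ∈ Ω, ‖recessiveTerm H V n x‖ ≤ (1 / 2) ^ n := by
  induction n with
  | zero => exact ⟨differentiableOn_const 1, fun x _ => by simp [recessiveTerm]⟩
  | succ n ih =>
    refine ⟨(rayIntegral_hasDerivAt h.isOpen h.invariant
      (h.recessiveIntegral_hasDerivAt ih.1 ih.2).1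
      (h.locallyDecays_recessiveIntegral ih.2)).1, fun x hx => ?_⟩
    refine (h.norm_rayIntegral_recessiveIntegral_le ih.2 hx).trans ?_
    rw [pow_succ']
    exact mul_le_mul_of_nonneg_right (h.small x hx) (by positivity)

theorem summable_half_pow (K : ℝ) : Summable fun n : ℕ => K * (1 / 2 : ℝ) ^ n :=
  summable_geometric_two.mul_left K

/-- Existence of the recessive solution of `z'' = H' z' + V z` with `z → 1` along rays. -/
theorem exists_recessive [FiniteDimensional ℂ P] (h : KernelBound Ω H H' V β A e) :
    ∃ z u : ℂ × P → ℂ, DifferentiableOn ℂ z Ω ∧ DifferentiableOn ℂ u Ω ∧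
      ∀ x ∈ Ω, HasDerivAt (fun q => z (q, x.2)) (u x) x.1 ∧
        HasDerivAt (fun q => u (q, x.2)) (H' x * u x + V x * z x) x.1 ∧
        ‖z x - 1‖ ≤ 2 * A / e * Real.exp (-e * x.1.re) := by
  let z := recessiveTerm H V
  let j : ℕ → ℂ × P → ℂ := fun n => recessiveIntegral H V (z n)
  have hz := h.recessiveTerm_spec
  have hj : ∀ n, DifferentiableOn ℂ (j n) Ω := fun n =>
    (h.recessiveIntegral_hasDerivAt (hz n).1 (hz n).2).1
  have hj' : ∀ n, ∀ x ∈ Ω, HasDerivAt (fun q => j n (q, x.2)) (H' x * j n x - V x * z n x) x.1 :=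
    fun n => (h.recessiveIntegral_hasDerivAt (hz n).1 (hz n).2).2
  have hjn : ∀ n, ∀ x ∈ Ω, ‖j n x‖ ≤ A * Real.exp (-e * x.1.re) * (1 / 2) ^ n := fun n x hx =>
    (h.norm_recessiveIntegral_le (hz n).2 hx).trans (le_of_eq (by ring))
  have hz' : ∀ n, ∀ x ∈ Ω, HasDerivAt (fun q => z (n + 1) (q, x.2)) (-j n x) x.1 := fun n =>
    (rayIntegral_hasDerivAt h.isOpen h.invariant (hj n)
      (h.locallyDecays_recessiveIntegral (hz n).2)).2
  have hA := h.A_nonneg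
  -- Local bounds for the coefficients, which dominate the differentiated series by a geometric one.
  have hloc : ∀ x ∈ Ω, ∃ K : ℝ, ∃ r > 0, ∀ y ∈ ball x r, y ∈ Ω ∧
      A * Real.exp (-e * y.1.re) ≤ K ∧ ‖H' y‖ * (A * Real.exp (-e * y.1.re)) + ‖V y‖ ≤ K := by
    intro x hx
    have hΩx := h.isOpen.mem_nhds hx
    let c : ℂ × P → ℝ := fun y => A * Real.exp (-e * y.1.re)
    let d : ℂ × P → ℝ := fun y => ‖H' y‖ * c y + ‖V y‖
    have hc : ContinuousOn c Ω := Continuous.continuousOn (by fun_prop)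
    have hd : ContinuousOn d Ω :=
      (h.continuousOn_H'.norm.mul hc).add h.differentiableOn_V.continuousOn.norm
    have hev : ∀ᶠ y in 𝓝 x, y ∈ Ω ∧ c y ≤ max (c x + 1) (d x + 1) ∧
        d y ≤ max (c x + 1) (d x + 1) := by
      filter_upwards [hΩx, (hc.continuousAt hΩx).eventually (gt_mem_nhds (lt_add_one (c x))),
        (hd.continuousAt hΩx).eventually (gt_mem_nhds (lt_add_one (d x)))] with y h1 h2 h3
      exact ⟨h1, h2.le.trans (le_max_left _ _), h3.le.trans (le_max_right _ _)⟩
    obtain ⟨r, hr, hsub⟩ := Metric.mem_nhds_iff.1 hev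
    exact ⟨_, r, hr, fun y hy => hsub hy⟩
  have hzs : ∀ x ∈ Ω, Summable fun n => z n x := fun x hx =>
    (summable_half_pow 1).of_norm_bounded fun n => by simpa using (hz n).2 x hx
  have hjs : ∀ x ∈ Ω, Summable fun n => j n x := fun x hx =>
    (summable_half_pow _).of_norm_bounded fun n => hjn n x hx
  refine ⟨fun x => ∑' n, z n x, fun x => -∑' n, j n x, ?_, ?_, fun x hx => ⟨?_, ?_, ?_⟩⟩
  · refine differentiableOn_tsum_of_locally_summable h.isOpen (fun n => (hz n).1) fun x hx => ?_
    refine ⟨_, summable_half_pow 1, ?_⟩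
    filter_upwards [h.isOpen.mem_nhds hx] with y hy n
    simpa using (hz n).2 y hy
  · refine (differentiableOn_tsum_of_locally_summable h.isOpen hj fun x hx => ?_).neg
    obtain ⟨K, r, hr, hK⟩ := hloc x hx
    refine ⟨_, summable_half_pow K, ?_⟩
    filter_upwards [ball_mem_nhds x hr] with y hy n
    obtain ⟨h1, h2, -⟩ := hK y hy
    exact (hjn n y h1).trans (mul_le_mul_of_nonneg_right h2 (by positivity))
  · obtain ⟨K, r, hr, hK⟩ := hloc x hx
    have hmem : ∀ q ∈ ball x.1 r, (q, x.2) ∈ ball x r := fun q hq => by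
      simpa [Prod.dist_eq, mem_ball, hr] using hq
    have hx1 := mem_ball_self (x := x.1) hr
    have h1 := hasDerivAt_tsum_of_isPreconnected (𝕜 := ℂ) (t := ball x.1 r) (y₀ := x.1) (y := x.1)
      (g := fun n q => z (n + 1) (q, x.2)) (g' := fun n q => -j n (q, x.2))
      (summable_half_pow K) isOpen_ball (convex_ball _ _).isPreconnected
      (fun n q hq => hz' n (q, x.2) (hK _ (hmem q hq)).1) (fun n q hq => ?_) hx1
      ((summable_nat_add_iff 1).2 (hzs x hx)) hx1
    · rw [tsum_neg] at h1
      refine (h1.const_add 1).congr_of_eventuallyEq ?_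
      filter_upwards [ball_mem_nhds x.1 hr] with q hq
      exact (hzs _ (hK _ (hmem q hq)).1).tsum_eq_zero_add
    · obtain ⟨h1, h2, -⟩ := hK _ (hmem q hq)
      rw [norm_neg]
      exact (hjn n _ h1).trans (mul_le_mul_of_nonneg_right h2 (by positivity))
  · obtain ⟨K, r, hr, hK⟩ := hloc x hx
    have hmem : ∀ q ∈ ball x.1 r, (q, x.2) ∈ ball x r := fun q hq => by
      simpa [Prod.dist_eq, mem_ball, hr] using hq
    have hx1 := mem_ball_self (x := x.1) hr
    have h1 := hasDerivAt_tsum_of_isPreconnected (𝕜 := ℂ) (t := ball x.1 r) (y₀ := x.1) (y := x.1)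
      (g := fun n q => j n (q, x.2))
      (g' := fun n q => H' (q, x.2) * j n (q, x.2) - V (q, x.2) * z n (q, x.2))
      (summable_half_pow K) isOpen_ball (convex_ball _ _).isPreconnected
      (fun n q hq => hj' n (q, x.2) (hK _ (hmem q hq)).1) (fun n q hq => ?_) hx1 (hjs x hx) hx1
    · refine h1.neg.congr_deriv ?_
      rw [Summable.tsum_sub ((hjs x hx).mul_left _) ((hzs x hx).mul_left _), tsum_mul_left,
        tsum_mul_left]
      ring
    · obtain ⟨h1, -, h3⟩ := hK _ (hmem q hq)
      refine (norm_sub_le _ _).trans ?_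
      rw [norm_mul, norm_mul]
      refine (add_le_add (mul_le_mul_of_nonneg_left (hjn n _ h1) (norm_nonneg _))
        (mul_le_mul_of_nonneg_left ((hz n).2 _ h1) (norm_nonneg _))).trans ?_
      refine le_trans (le_of_eq ?_) (mul_le_mul_of_nonneg_right h3 (by positivity))
      ring
  · have h1 : ∑' n, z n x - 1 = ∑' n, z (n + 1) x := by
      rw [(hzs x hx).tsum_eq_zero_add]
      exact add_sub_cancel_left _ _
    change ‖∑' n, z n x - 1‖ ≤ _
    rw [h1]
    -- The last iteration in each term is estimated by its explicit factor and not by `1 / 2`; this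
    -- preserves the decay in `re p`.
    have h2 : HasSum (fun n : ℕ => A / e * Real.exp (-e * x.1.re) * (1 / 2 : ℝ) ^ n)
        (A / e * Real.exp (-e * x.1.re) * 2) := hasSum_geometric_two.mul_left _
    refine (tsum_of_norm_bounded h2 fun n =>
      h.norm_rayIntegral_recessiveIntegral_le (hz n).2 hx).trans (le_of_eq (by ring))

end KernelBound

end Recessive

/-! ### Inequalities between the exponents. -/

section Exponents

variable {α : ℝ}

theorem two_mul_truncation_le (hα : 0 < α) : 2 * α * truncation α ≤ 1 + α := by
  have h : (truncation α : ℝ) ≤ (1 + α) / (2 * α) := Nat.floor_le (by positivity)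
  rw [le_div_iff₀ (by positivity)] at h
  linarith

/-- This is the strict upper inequality for the floor, multiplied by `2 * α`. -/
theorem dExp_pos (hα : 0 < α) : 0 < dExp α := by
  have h : (1 + α) / (2 * α) < (truncation α : ℝ) + 1 := Nat.lt_floor_add_one _
  rw [div_lt_iff₀ (by positivity)] at h
  rw [dExp]
  linarith

theorem eExp_pos (hα : 0 < α) : 0 < eExp α := lt_min (dExp_pos hα) (by linarith)

theorem eExp_le_add_one : eExp α ≤ α + 1 := min_le_right _ _

theorem eExp_le_dExp : eExp α ≤ dExp α := min_le_left _ _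

/-- Needed to absorb the term of `wkbDefect` of size `|x| ^ (1 - α)` that contains the derivative of
the Taylor polynomial. -/
theorem eExp_le_two_mul (hα : 0 < α) : eExp α ≤ 2 * α := by
  have h := two_mul_truncation_le hα
  refine eExp_le_dExp.trans ?_
  rw [dExp]
  linarith

end Exponents

/-! ### The Taylor polynomial of the square root. -/

section SquareRoot

open Polynomial

theorem sqrtCoeff_zero : sqrtCoeff 0 = 1 := by simp [sqrtCoeff]

theorem iteratedDeriv_one_sub (n : ℕ) :
    iteratedDeriv n (fun t : ℂ => 1 - t) 0 / n.factorial = (1 - X : ℂ[X]).coeff n := by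
  have hd : deriv (fun t : ℂ => 1 - t) = fun _ => -1 := by
    funext t
    simp
  match n with
  | 0 => simp
  | 1 => simp [iteratedDeriv_one, hd, coeff_one, coeff_X]
  | n + 2 =>
    rw [iteratedDeriv_succ', hd, iteratedDeriv_const]
    simp [coeff_one, coeff_X]

/-- The Leibniz rule applied to the square of `(1 - t) ^ (1 / 2)`, divided by `n!`. -/
theorem sum_sqrtCoeff_mul (n : ℕ) :
    ∑ i ∈ Finset.range (n + 1), sqrtCoeff i * sqrtCoeff (n - i) = (1 - X : ℂ[X]).coeff n := by
  set f : ℂ → ℂ := fun t => (1 - t) ^ (1 / 2 : ℂ) with hf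
  have hsq : f * f = fun t => 1 - t := by
    funext t
    have := Complex.cpow_nat_inv_pow (1 - t) two_ne_zero
    simp only [hf, Pi.mul_apply, ← sq, one_div]
    exact_mod_cast this
  have hc : ContDiffAt ℂ n f 0 := by
    refine (analyticAt_const.sub analyticAt_id).cpow analyticAt_const ?_ |>.contDiffAt
    simp
  rw [← iteratedDeriv_one_sub, ← hsq, iteratedDeriv_mul hc hc, Finset.sum_div]
  refine Finset.sum_congr rfl fun i hi => ?_
  have hi' : i ≤ n := Nat.lt_succ_iff.1 (Finset.mem_range.1 hi)
  rw [sqrtCoeff, sqrtCoeff, Nat.cast_choose ℂ hi', ← hf]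
  have h1 := Nat.cast_ne_zero (R := ℂ).2 n.factorial_ne_zero
  have h2 := Nat.cast_ne_zero (R := ℂ).2 i.factorial_ne_zero
  have h3 := Nat.cast_ne_zero (R := ℂ).2 (n - i).factorial_ne_zero
  field_simp

/-- The Taylor polynomial of degree `N` of `(1 - t) ^ (1 / 2)`. -/
def sqrtPoly (N : ℕ) : ℂ[X] := ∑ j ∈ Finset.range (N + 1), C (sqrtCoeff j) * X ^ j

theorem sqrtPoly_coeff {N j : ℕ} (hj : j ≤ N) : (sqrtPoly N).coeff j = sqrtCoeff j := by
  simp only [sqrtPoly, finsetSum_coeff, coeff_C_mul_X_pow]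
  rw [Finset.sum_ite_eq]
  simp [Nat.lt_succ_iff.2 hj]

theorem sqrtPoly_eval (N : ℕ) (t : ℂ) :
    (sqrtPoly N).eval t = ∑ j ∈ Finset.range (N + 1), sqrtCoeff j * t ^ j := by
  simp [sqrtPoly, eval_finsetSum]

theorem sqrtPoly_eval_zero (N : ℕ) : (sqrtPoly N).eval 0 = 1 := by
  rw [← coeff_zero_eq_eval_zero, sqrtPoly_coeff N.zero_le, sqrtCoeff_zero]

/-- The coefficients of the square up to degree `N` involve only coefficients unaffected by
truncation. -/
theorem exists_sqrtPoly_sq (N : ℕ) :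
    ∃ G : ℂ[X], sqrtPoly N ^ 2 = 1 - X + X ^ (N + 1) * G := by
  have h : X ^ (N + 1) ∣ sqrtPoly N ^ 2 - (1 - X) := by
    rw [X_pow_dvd_iff]
    intro d hd
    rw [coeff_sub, sub_eq_zero, ← sum_sqrtCoeff_mul, sq, coeff_mul,
      Finset.Nat.sum_antidiagonal_eq_sum_range_succ_mk]
    refine Finset.sum_congr rfl fun i hi => ?_
    have hi' : i ≤ d := Nat.lt_succ_iff.1 (Finset.mem_range.1 hi)
    rw [sqrtPoly_coeff (by omega), sqrtPoly_coeff (by omega)]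
  obtain ⟨G, hG⟩ := h
  exact ⟨G, by rw [← hG]; ring⟩

/-- The cofactor `G` in `(sqrtPoly N) ^ 2 = 1 - X + X ^ (N + 1) * G`. -/
def sqrtDefect (N : ℕ) : ℂ[X] := (exists_sqrtPoly_sq N).choose

theorem sqrtPoly_eval_sq (N : ℕ) (t : ℂ) :
    (sqrtPoly N).eval t ^ 2 = 1 - t + t ^ (N + 1) * (sqrtDefect N).eval t := by
  have h := congrArg (eval t) (exists_sqrtPoly_sq N).choose_spec
  simpa [sqrtDefect] using h

theorem exists_norm_eval_le (p : ℂ[X]) (r : ℝ) :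
    ∃ K : ℝ, 0 ≤ K ∧ ∀ t : ℂ, ‖t‖ ≤ r → ‖p.eval t‖ ≤ K := by
  obtain ⟨K, hK⟩ := (isCompact_closedBall (0 : ℂ) r).exists_bound_of_continuousOn
    p.continuous.continuousOn
  exact ⟨max K 0, le_max_right _ _, fun t ht => (hK t (by simpa using ht)).trans (le_max_left _ _)⟩

end SquareRoot

/-! ### The WKB ansatz in the variable `log x`. -/

section WKB

variable (α : ℝ) (k : ℤ)

/-- The variable `E x ^ (-2 α)`. -/
def reducedEnergy (x : ℂ × ℂ × ℂ) : ℂ := x.2.1 * Complex.exp (-2 * α * x.1)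

/-- The derivative of the truncated action with respect to `log x`, with the sign `(-1) ^ k`. -/
def momentum (x : ℂ × ℂ × ℂ) : ℂ :=
  (-1) ^ k * Complex.exp ((α + 1) * x.1) * (sqrtPoly (truncation α)).eval (reducedEnergy α x)

/-- The derivative of `momentum` with respect to `log x`. -/
def momentumDeriv (x : ℂ × ℂ × ℂ) : ℂ :=
  (α + 1) * momentum α k x - 2 * α * ((-1) ^ k * Complex.exp ((α + 1) * x.1) *
    (reducedEnergy α x * (sqrtPoly (truncation α)).derivative.eval (reducedEnergy α x)))

/-- The potential in the variable `log x`. -/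
def logPotential (x : ℂ × ℂ × ℂ) : ℂ :=
  Complex.exp (2 * (α + 1) * x.1) + x.2.2 * (x.2.2 + 1) - x.2.1 * Complex.exp (2 * x.1)

/-- The logarithm of the WKB factor `x ^ (-α / 2) exp ((-1) ^ (k + 1) R(x))`. -/
def wkbExponent (x : ℂ × ℂ × ℂ) : ℂ :=
  -(α / 2 * x.1) - (-1) ^ k * truncatedAction α x.2.1 x.1

/-- The exponent `H` in the equation `z'' = H' z' + V z` for the amplitude. -/
def wkbPhase (x : ℂ × ℂ × ℂ) : ℂ :=
  2 * ((-1) ^ k * truncatedAction α x.2.1 x.1) + (α + 1) * x.1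

/-- The coefficient `V` in the equation `z'' = H' z' + V z` for the amplitude. -/
def wkbDefect (x : ℂ × ℂ × ℂ) : ℂ :=
  x.2.2 * (x.2.2 + 1) - α ^ 2 / 4 - α / 2
    - Complex.exp (2 * (α + 1) * x.1) *
      (reducedEnergy α x ^ (truncation α + 1) *
        (sqrtDefect (truncation α)).eval (reducedEnergy α x))
    - 2 * α * ((-1) ^ k * Complex.exp ((α + 1) * x.1) *
      (reducedEnergy α x * (sqrtPoly (truncation α)).derivative.eval (reducedEnergy α x)))

theorem neg_one_zpow_sq : ((-1 : ℂ) ^ k) ^ 2 = 1 := by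
  rw [← zpow_natCast, ← zpow_mul, mul_comm, zpow_mul]
  simp

/-- The prefactor `x ^ (-α / 2)` is chosen so that the terms linear in `momentum` cancel; the square
of `momentum` cancels the potential up to the Taylor remainder. -/
theorem wkbDefect_eq (x : ℂ × ℂ × ℂ) :
    wkbDefect α k x = logPotential α x + (-(α / 2) - momentum α k x)
      - (-(α / 2) - momentum α k x) ^ 2 + momentumDeriv α k x := by
  have h1 := neg_one_zpow_sq k
  have h2 := sqrtPoly_eval_sq (truncation α) (reducedEnergy α x)
  have h3 : Complex.exp (2 * (α + 1) * x.1) = Complex.exp ((α + 1) * x.1) ^ 2 := by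
    rw [← Complex.exp_nat_mul]
    push_cast
    ring_nf
  have h4 : x.2.1 * Complex.exp (2 * x.1) =
      Complex.exp ((α + 1) * x.1) ^ 2 * reducedEnergy α x := by
    rw [reducedEnergy, ← Complex.exp_nat_mul, mul_left_comm, ← Complex.exp_add]
    push_cast
    ring_nf
  simp only [wkbDefect, logPotential, momentumDeriv, momentum] at *
  rw [h3, h4]
  generalize (sqrtPoly (truncation α)).eval (reducedEnergy α x) = a at *
  generalize reducedEnergy α x ^ (truncation α + 1) *
    (sqrtDefect (truncation α)).eval (reducedEnergy α x) = b at *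
  generalize Complex.exp ((α + 1) * x.1) = c at *
  linear_combination (c ^ 2 * a ^ 2) * h1 + c ^ 2 * h2

variable {α}

theorem actionTerm_hasDerivAt (E : ℂ) (p : ℂ) {j : ℕ} (hj : α * (1 - 2 * (j : ℝ)) + 1 ≠ 0) :
    HasDerivAt (fun q : ℂ => actionTerm α E q j)
      (Complex.exp ((α + 1) * p) * (sqrtCoeff j * (E * Complex.exp (-2 * α * p)) ^ j)) p := by
  simp only [actionTerm, Cover.pow, Cover.log]
  have hb : ((α * (1 - 2 * (j : ℝ)) + 1 : ℝ) : ℂ) ≠ 0 := Complex.ofReal_ne_zero.2 hj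
  have h := ((((hasDerivAt_id p).const_mul ((α * (1 - 2 * (j : ℝ)) + 1 : ℝ) : ℂ)).cexp.div_const
    ((α * (1 - 2 * (j : ℝ)) + 1 : ℝ) : ℂ)).const_mul (sqrtCoeff j * E ^ j))
  refine h.congr_deriv ?_
  have e1 : Complex.exp (((α * (1 - 2 * (j : ℝ)) + 1 : ℝ) : ℂ) * p) =
      Complex.exp ((α + 1) * p) * Complex.exp (-2 * α * p) ^ j := by
    rw [← Complex.exp_nat_mul, ← Complex.exp_add]
    push_cast
    ring_nf
  simp only [id, mul_one]
  rw [e1, mul_div_assoc, div_self hb]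
  ring

/-- The two cases in the definition of the action have the same derivative: at resonance the term of
index `m` is the constant `c_m E ^ m`, whose primitive in `log x` is linear. -/
theorem truncatedAction_hasDerivAt (hα : 0 < α) (E p : ℂ) :
    HasDerivAt (fun q : ℂ => truncatedAction α E q)
      (Complex.exp ((α + 1) * p) * (sqrtPoly (truncation α)).eval (E * Complex.exp (-2 * α * p)))
      p := by
  rw [sqrtPoly_eval, Finset.range_eq_Ico, Finset.sum_eq_sum_Ico_succ_bot (Nat.succ_pos _),
    zero_add, mul_add, Finset.mul_sum]
  have h0 : HasDerivAt (fun q : ℂ => Cover.pow q (α + 1) / ((α + 1 : ℝ) : ℂ))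
      (Complex.exp ((α + 1) * p) * (sqrtCoeff 0 * (E * Complex.exp (-2 * α * p)) ^ 0)) p := by
    simp only [Cover.pow, Cover.log]
    refine (((hasDerivAt_id p).const_mul ((α + 1 : ℝ) : ℂ)).cexp.div_const
      ((α + 1 : ℝ) : ℂ)).congr_deriv ?_
    have hb : ((α + 1 : ℝ) : ℂ) ≠ 0 := Complex.ofReal_ne_zero.2 (by linarith)
    simp only [id, mul_one, sqrtCoeff_zero, pow_zero]
    rw [mul_div_assoc, div_self hb]
    simp
  by_cases hres : IsResonant α
  · obtain ⟨m, hm, hαm⟩ := id hres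
    have hN : truncation α = m := by rw [hαm, truncation_of_resonant m hm]
    have hm' : (1 : ℝ) ≤ m := by exact_mod_cast hm
    have hne : (2 * (m : ℝ) - 1) ≠ 0 := by linarith
    simp only [truncatedAction, if_pos hres, hN]
    rw [Finset.sum_Ico_succ_top hm, ← add_assoc]
    refine (h0.add (HasDerivAt.fun_sum fun j hj => actionTerm_hasDerivAt E p ?_)).add ?_
    · have hj' : (j : ℝ) < m := by exact_mod_cast (Finset.mem_Ico.1 hj).2
      have : α * (1 - 2 * (j : ℝ)) + 1 = 2 * α * (m - j) := by
        rw [hαm]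
        field_simp
        ring
      rw [this]
      have := sub_pos.2 hj'
      positivity
    · simp only [Cover.log]
      refine ((hasDerivAt_id p).const_mul (sqrtCoeff m * E ^ m)).congr_deriv ?_
      have e1 : Complex.exp ((α + 1) * p) * Complex.exp (-2 * α * p) ^ m = 1 := by
        have : (α : ℂ) * (2 * m - 1) = 1 := by
          have : α * (2 * m - 1) = 1 := by rw [hαm]; field_simp
          exact_mod_cast this
        have h : ((α : ℂ) + 1) * p + m * (-2 * α * p) = 0 := by linear_combination (-p) * this
        rw [← Complex.exp_nat_mul, ← Complex.exp_add, h, Complex.exp_zero]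
      rw [mul_pow]
      linear_combination (-(sqrtCoeff m * E ^ m)) * e1
  · simp only [truncatedAction, if_neg hres]
    refine h0.add (HasDerivAt.fun_sum fun j hj => actionTerm_hasDerivAt E p ?_)
    -- A vanishing exponent denominator would force `α = 1 / (2 j - 1)`, a resonance.
    intro h
    have hj := (Finset.mem_Ico.1 hj).1
    have hj' : (1 : ℝ) ≤ j := by exact_mod_cast hj
    refine hres ⟨j, hj, ?_⟩
    rw [eq_div_iff (by linarith)]
    linarith

theorem truncatedAction_differentiable :
    Differentiable ℂ fun x : ℂ × ℂ × ℂ => truncatedAction α x.2.1 x.1 := by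
  by_cases hres : IsResonant α
  · simp only [truncatedAction, if_pos hres, actionTerm, Cover.pow, Cover.log]
    fun_prop
  · simp only [truncatedAction, if_neg hres, actionTerm, Cover.pow, Cover.log]
    fun_prop

theorem reducedEnergy_hasDerivAt (x : ℂ × ℂ × ℂ) :
    HasDerivAt (fun q => reducedEnergy α (q, x.2)) (-2 * α * reducedEnergy α x) x.1 := by
  simp only [reducedEnergy]
  refine (((hasDerivAt_id x.1).const_mul (-2 * (α : ℂ))).cexp.const_mul x.2.1).congr_deriv ?_
  simp only [id]
  ring

theorem momentum_hasDerivAt (x : ℂ × ℂ × ℂ) :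
    HasDerivAt (fun q => momentum α k (q, x.2)) (momentumDeriv α k x) x.1 := by
  simp only [momentum]
  have h1 := (((hasDerivAt_id x.1).const_mul ((α : ℂ) + 1)).cexp.const_mul ((-1 : ℂ) ^ k))
  have h2 := ((sqrtPoly (truncation α)).hasDerivAt (reducedEnergy α x)).comp x.1
    (reducedEnergy_hasDerivAt (α := α) x)
  refine (h1.mul h2).congr_deriv ?_
  simp only [momentumDeriv, momentum, Function.comp, id]
  ring

theorem wkbExponent_hasDerivAt (hα : 0 < α) (x : ℂ × ℂ × ℂ) :
    HasDerivAt (fun q => wkbExponent α k (q, x.2)) (-(α / 2) - momentum α k x) x.1 := by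
  simp only [wkbExponent]
  refine (((hasDerivAt_id x.1).const_mul ((α : ℂ) / 2)).neg.sub
    ((truncatedAction_hasDerivAt hα x.2.1 x.1).const_mul ((-1 : ℂ) ^ k))).congr_deriv ?_
  simp only [momentum, reducedEnergy]
  ring

theorem wkbPhase_hasDerivAt (hα : 0 < α) (x : ℂ × ℂ × ℂ) :
    HasDerivAt (fun q => wkbPhase α k (q, x.2)) (2 * momentum α k x + (α + 1)) x.1 := by
  simp only [wkbPhase]
  refine ((((truncatedAction_hasDerivAt hα x.2.1 x.1).const_mul ((-1 : ℂ) ^ k)).const_mul 2).add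
    ((hasDerivAt_id x.1).const_mul ((α : ℂ) + 1))).congr_deriv ?_
  simp only [momentum, reducedEnergy]
  ring

theorem wkbExponent_differentiable : Differentiable ℂ (wkbExponent α k) := by
  have := truncatedAction_differentiable (α := α)
  unfold wkbExponent
  fun_prop

theorem wkbPhase_differentiable : Differentiable ℂ (wkbPhase α k) := by
  have := truncatedAction_differentiable (α := α)
  unfold wkbPhase
  fun_prop

theorem reducedEnergy_differentiable : Differentiable ℂ (reducedEnergy α) := by
  unfold reducedEnergy
  fun_prop

theorem eval_reducedEnergy_differentiable (f : Polynomial ℂ) :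
    Differentiable ℂ fun x => f.eval (reducedEnergy α x) :=
  f.differentiable.comp reducedEnergy_differentiable

theorem momentum_differentiable : Differentiable ℂ (momentum α k) := by
  have := eval_reducedEnergy_differentiable (α := α) (sqrtPoly (truncation α))
  unfold momentum
  fun_prop

theorem wkbDefect_differentiable : Differentiable ℂ (wkbDefect α k) := by
  have h1 := eval_reducedEnergy_differentiable (α := α) (sqrtPoly (truncation α)).derivative
  have h2 := eval_reducedEnergy_differentiable (α := α) (sqrtDefect (truncation α))
  have h3 := reducedEnergy_differentiable (α := α)
  unfold wkbDefect
  fun_prop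

end WKB

/-! ### Growth of the phase and size of the defect in a subsector. -/

section Estimates

variable {α : ℝ} {k : ℤ} {η M r : ℝ}

/-- The points far out in a subsector of the `k`-th Stokes sector, with bounded parameters. -/
def sectorDomain (α : ℝ) (k : ℤ) (η M r : ℝ) : Set (ℂ × ℂ × ℂ) :=
  {x | M < x.1.re ∧ |x.1.im - (k : ℝ) * Real.pi / (α + 1)| < Real.pi / (2 * α + 2) - η ∧
    x.2 ∈ ball 0 r}

theorem isOpen_sectorDomain : IsOpen (sectorDomain α k η M r) := by
  have h1 : Continuous fun x : ℂ × ℂ × ℂ => x.1.re := by fun_prop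
  have h2 : Continuous fun x : ℂ × ℂ × ℂ => |x.1.im - (k : ℝ) * Real.pi / (α + 1)| := by fun_prop
  exact (isOpen_lt continuous_const h1).inter
    ((isOpen_lt h2 continuous_const).inter (isOpen_ball.preimage continuous_snd))

theorem forwardInvariant_sectorDomain : ForwardInvariant (sectorDomain α k η M r) := by
  rintro x ⟨h1, h2, h3⟩ t ht
  refine ⟨?_, by simpa using h2, h3⟩
  simp only [Complex.add_re, Complex.ofReal_re]
  linarith

theorem sin_pos_of_width (hα : 0 < α) (hη : 0 < η) (hη' : η < Real.pi / (2 * α + 2)) :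
    0 < Real.sin ((α + 1) * η) := by
  rw [lt_div_iff₀ (by linarith)] at hη'
  exact Real.sin_pos_of_pos_of_lt_pi (by positivity) (by nlinarith)

/-- The sign `(-1) ^ k` compensates the rotation by `k π`, leaving the cosine of an angle at
distance at least `(α + 1) η` from `± π / 2`. -/
theorem leading_re_ge (hα : 0 < α) (hη : 0 < η) {p : ℂ}
    (hp : |p.im - (k : ℝ) * Real.pi / (α + 1)| ≤ Real.pi / (2 * α + 2) - η) :
    Real.sin ((α + 1) * η) * Real.exp ((α + 1) * p.re) ≤
      ((-1) ^ k * Complex.exp ((α + 1) * p)).re := by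
  have ha : 0 < α + 1 := by linarith
  set y : ℝ := (α + 1) * (p.im - (k : ℝ) * Real.pi / (α + 1)) with hy
  have e1 : ((-1 : ℂ) ^ k * Complex.exp ((α + 1) * p)).re =
      Real.exp ((α + 1) * p.re) * Real.cos y := by
    have h1 : (α + 1) * p.im = y + k * Real.pi := by
      rw [hy]
      field_simp
      ring
    have h2 : ((-1 : ℂ) ^ k) = (((-1 : ℝ) ^ k : ℝ) : ℂ) := by push_cast; rfl
    have h3 : ((-1 : ℝ) ^ k) * (-1 : ℝ) ^ k = 1 := by
      rw [← mul_zpow]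
      simp
    have h4 : ((α : ℂ) + 1) * p = ((α + 1 : ℝ) : ℂ) * p := by push_cast; rfl
    rw [h2, Complex.re_ofReal_mul, Complex.exp_re, h4, Complex.re_ofReal_mul,
      Complex.im_ofReal_mul, h1, Real.cos_add_int_mul_pi]
    linear_combination (Real.exp ((α + 1) * p.re) * Real.cos y) * h3
  have e2 : |y| ≤ Real.pi / 2 - (α + 1) * η := by
    rw [hy, abs_mul, abs_of_pos ha]
    refine (mul_le_mul_of_nonneg_left hp ha.le).trans (le_of_eq ?_)
    have : 2 * α + 2 = 2 * (α + 1) := by ring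
    rw [this]
    field_simp
  have e3 : Real.sin ((α + 1) * η) ≤ Real.cos y := by
    rw [← Real.cos_abs y, ← Real.cos_pi_div_two_sub]
    refine Real.cos_le_cos_of_nonneg_of_le_pi (abs_nonneg y) ?_ e2
    have : 0 < (α + 1) * η := by positivity
    linarith [Real.pi_pos]
  rw [e1, mul_comm]
  exact mul_le_mul_of_nonneg_left e3 (Real.exp_pos _).le

theorem norm_reducedEnergy_le {x : ℂ × ℂ × ℂ} (hx : x.2 ∈ ball 0 r) :
    ‖reducedEnergy α x‖ ≤ r * Real.exp (-2 * α * x.1.re) := by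
  have h1 : ‖x.2.1‖ ≤ r := (norm_fst_le x.2).trans (mem_ball_zero_iff.1 hx).le
  have h2 : (-2 * (α : ℂ) * x.1).re = -2 * α * x.1.re := by
    simp [Complex.mul_re]
  rw [reducedEnergy, norm_mul, Complex.norm_exp, h2]
  exact mul_le_mul_of_nonneg_right h1 (Real.exp_pos _).le

theorem norm_exp_ofReal_mul (b : ℝ) (p : ℂ) : ‖Complex.exp (b * p)‖ = Real.exp (b * p.re) := by
  rw [Complex.norm_exp, Complex.re_ofReal_mul]

theorem norm_neg_one_zpow (k : ℤ) : ‖(-1 : ℂ) ^ k‖ = 1 := by simp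

/-- The real part of the derivative of the phase grows like `|x| ^ (α + 1)` in the subsector. -/
theorem exists_re_phase_ge (hα : 0 < α) (k : ℤ) (hη : 0 < η) (hη' : η < Real.pi / (2 * α + 2))
    (r : ℝ) :
    ∃ M₀ : ℝ, ∀ x ∈ sectorDomain α k η M₀ r,
      Real.sin ((α + 1) * η) * Real.exp ((α + 1) * x.1.re) ≤
        (2 * momentum α k x + (α + 1)).re := by
  have hσ := sin_pos_of_width hα hη hη'
  set σ := Real.sin ((α + 1) * η) with hσdef
  have hcont : Tendsto (fun t : ℂ => ‖(sqrtPoly (truncation α)).eval t - 1‖) (𝓝 0) (𝓝 0) := by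
    have h := ((sqrtPoly (truncation α)).continuous.sub
      (continuous_const (y := (1 : ℂ)))).norm.tendsto 0
    simpa [sqrtPoly_eval_zero] using h
  obtain ⟨δ, hδ, hδ'⟩ := Metric.eventually_nhds_iff.1 (hcont.eventually (gt_mem_nhds (half_pos hσ)))
  have hlim : Tendsto (fun ρ : ℝ => r * Real.exp (-2 * α * ρ)) atTop (𝓝 0) := by
    have := tendsto_const_mul_exp_neg r (δ := 2 * α) (by linarith)
    simpa using this
  obtain ⟨M₀, hM₀⟩ := eventually_atTop.1 (hlim.eventually (gt_mem_nhds hδ))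
  refine ⟨M₀, fun x hx => ?_⟩
  obtain ⟨h1, h2, h3⟩ := hx
  -- The leading part of twice the momentum contributes `2 σ` times the exponential; a relative
  -- error below `σ / 2` costs at most `σ`, so `σ` remains.
  have hX : ‖(sqrtPoly (truncation α)).eval (reducedEnergy α x) - 1‖ < σ / 2 := by
    apply hδ'
    rw [dist_zero_right]
    exact (norm_reducedEnergy_le h3).trans_lt (hM₀ _ h1.le)
  have hlead := leading_re_ge (k := k) hα hη h2.le
  set L : ℂ := (-1) ^ k * Complex.exp ((α + 1) * x.1) with hL
  have hLn : ‖L‖ = Real.exp ((α + 1) * x.1.re) := by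
    have := norm_exp_ofReal_mul (α + 1) x.1
    push_cast at this
    rw [hL, norm_mul, norm_neg_one_zpow, one_mul, this]
  set q := (sqrtPoly (truncation α)).eval (reducedEnergy α x) - 1 with hq
  have hw : momentum α k x = L + L * q := by
    rw [momentum, hq, ← hL]
    ring
  have hLq : -(Real.exp ((α + 1) * x.1.re) * (σ / 2)) ≤ (L * q).re := by
    have h4 : ‖L * q‖ ≤ Real.exp ((α + 1) * x.1.re) * (σ / 2) := by
      rw [norm_mul, hLn]
      gcongr
    exact neg_le_of_neg_le (by linarith [(abs_le.1 (Complex.abs_re_le_norm (L * q))).1])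
  have hre : (2 * momentum α k x + (α + 1)).re = 2 * (L.re + (L * q).re) + (α + 1) := by
    rw [hw]
    simp
  rw [hre]
  linarith

/-- The coefficient `V` is `O(|x| ^ (α + 1 - e_α))`. -/
theorem exists_norm_wkbDefect_le (hα : 0 < α) (k : ℤ) (hr : 0 ≤ r) :
    ∃ C : ℝ, 0 ≤ C ∧ ∀ x : ℂ × ℂ × ℂ, 0 ≤ x.1.re → x.2 ∈ ball 0 r →
      ‖wkbDefect α k x‖ ≤ C * Real.exp ((α + 1 - eExp α) * x.1.re) := by
  obtain ⟨K₁, hK₁, hG⟩ := exists_norm_eval_le (sqrtDefect (truncation α)) r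
  obtain ⟨K₂, hK₂, hD⟩ := exists_norm_eval_le (sqrtPoly (truncation α)).derivative r
  refine ⟨r * (r + 1) + α ^ 2 / 4 + α / 2 + r ^ (truncation α + 1) * K₁ + 2 * α * (r * K₂),
    by positivity, fun x hx hxr => ?_⟩
  set ρ := x.1.re with hρ
  set X := reducedEnergy α x with hX
  have hXr : ‖X‖ ≤ r * Real.exp (-2 * α * ρ) := norm_reducedEnergy_le hxr
  have hXr' : ‖X‖ ≤ r := by
    refine hXr.trans (mul_le_of_le_one_right hr (Real.exp_le_one_iff.2 ?_))
    nlinarith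
  have hl : ‖x.2.2‖ ≤ r := (norm_snd_le x.2).trans (mem_ball_zero_iff.1 hxr).le
  have hexp : ∀ b : ℝ, b ≤ α + 1 - eExp α →
      Real.exp (b * ρ) ≤ Real.exp ((α + 1 - eExp α) * ρ) := fun b hb =>
    Real.exp_le_exp.2 (mul_le_mul_of_nonneg_right hb hx)
  have h1 : ‖x.2.2 * (x.2.2 + 1) - (α : ℂ) ^ 2 / 4 - α / 2‖ ≤
      (r * (r + 1) + α ^ 2 / 4 + α / 2) * Real.exp ((α + 1 - eExp α) * ρ) := by
    have e1 : ‖x.2.2 * (x.2.2 + 1)‖ ≤ r * (r + 1) := by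
      rw [norm_mul]
      have : ‖x.2.2 + 1‖ ≤ r + 1 := (norm_add_le _ _).trans (by simpa using hl)
      gcongr
    have e2 : ‖(α : ℂ) ^ 2 / 4‖ = α ^ 2 / 4 := by simp
    have e3 : ‖(α : ℂ) / 2‖ = α / 2 := by simp [abs_of_pos hα]
    have e4 := hexp 0 (by linarith [eExp_le_add_one (α := α)])
    rw [zero_mul, Real.exp_zero] at e4
    refine le_trans ?_ (le_mul_of_one_le_right (by positivity) e4)
    refine (norm_sub_le _ _).trans (add_le_add ((norm_sub_le _ _).trans
      (add_le_add e1 e2.le)) e3.le)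
  -- The Taylor remainder, where `d_α` arises: `2 (α + 1) - 2 α (N + 1) = α + 1 - d_α`.
  have h2 : ‖Complex.exp (2 * (α + 1) * x.1) * (X ^ (truncation α + 1) *
      (sqrtDefect (truncation α)).eval X)‖ ≤
      r ^ (truncation α + 1) * K₁ * Real.exp ((α + 1 - eExp α) * ρ) := by
    have e1 := norm_exp_ofReal_mul (2 * (α + 1)) x.1
    push_cast at e1
    rw [norm_mul, norm_mul, norm_pow, e1]
    calc _ ≤ Real.exp (2 * (α + 1) * ρ) * ((r * Real.exp (-2 * α * ρ)) ^ (truncation α + 1) *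
            K₁) := by
          gcongr
          exact hG X hXr'
      _ = r ^ (truncation α + 1) * K₁ * Real.exp ((α + 1 - dExp α) * ρ) := by
          rw [mul_pow, ← Real.exp_nat_mul]
          have : Real.exp ((α + 1 - dExp α) * ρ) = Real.exp (2 * (α + 1) * ρ) *
              Real.exp (((truncation α + 1 : ℕ) : ℝ) * (-2 * α * ρ)) := by
            rw [← Real.exp_add, dExp]
            push_cast
            ring_nf
          rw [this]
          ring
      _ ≤ _ := mul_le_mul_of_nonneg_left
          (hexp _ (by linarith [eExp_le_dExp (α := α)])) (by positivity)
  have h3 : ‖2 * (α : ℂ) * ((-1) ^ k * Complex.exp ((α + 1) * x.1) *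
      (X * (sqrtPoly (truncation α)).derivative.eval X))‖ ≤
      2 * α * (r * K₂) * Real.exp ((α + 1 - eExp α) * ρ) := by
    have e1 := norm_exp_ofReal_mul (α + 1) x.1
    push_cast at e1
    have e2 : ‖2 * (α : ℂ)‖ = 2 * α := by simp [abs_of_pos hα]
    rw [norm_mul, e2, norm_mul, norm_mul, norm_neg_one_zpow, one_mul, e1, norm_mul]
    calc _ ≤ 2 * α * (Real.exp ((α + 1) * ρ) * (r * Real.exp (-2 * α * ρ) * K₂)) := by
          gcongr
          exact hD X hXr'
      _ = 2 * α * (r * K₂) * Real.exp ((α + 1 - 2 * α) * ρ) := by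
          have : Real.exp ((α + 1 - 2 * α) * ρ) = Real.exp ((α + 1) * ρ) *
              Real.exp (-2 * α * ρ) := by
            rw [← Real.exp_add]
            ring_nf
          rw [this]
          ring
      _ ≤ _ := mul_le_mul_of_nonneg_left
          (hexp _ (by linarith [eExp_le_two_mul hα])) (by positivity)
  rw [wkbDefect]
  refine (norm_sub_le _ _).trans ((add_le_add ((norm_sub_le _ _).trans
    (add_le_add h1 h2)) h3).trans (le_of_eq ?_))
  ring

/-- Mean value inequality: the lower bound for the growth rate increases along the ray, so its value
at the initial point serves throughout. -/
theorem re_phase_sub_ge (hα : 0 < α) {σ : ℝ} (hσ : 0 ≤ σ)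
    (hphase : ∀ x ∈ sectorDomain α k η M r,
      σ * Real.exp ((α + 1) * x.1.re) ≤ (2 * momentum α k x + (α + 1)).re)
    {x : ℂ × ℂ × ℂ} (hx : x ∈ sectorDomain α k η M r) {t : ℝ} (ht : 0 ≤ t) :
    σ * Real.exp ((α + 1) * x.1.re) * t ≤
      (wkbPhase α k (x.1 + t, x.2)).re - (wkbPhase α k x).re := by
  let φ : ℝ → ℝ := fun s => (wkbPhase α k (x.1 + s, x.2)).re
  have hφ : ∀ s : ℝ, HasDerivAt φ (2 * momentum α k (x.1 + s, x.2) + (α + 1)).re s := by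
    intro s
    have h1 := wkbPhase_hasDerivAt (k := k) hα (x.1 + s, x.2)
    have h2 : HasDerivAt (fun s : ℝ => x.1 + (s : ℂ)) 1 s := by
      simpa using (Complex.ofRealCLM.hasDerivAt (x := s)).const_add x.1
    have h3 := HasDerivAt.comp s (h₂ := fun q => wkbPhase α k (q, x.2)) h1 h2
    rw [mul_one] at h3
    exact Complex.reCLM.hasFDerivAt.comp_hasDerivAt s h3
  have h := (convex_Ici (0 : ℝ)).mul_sub_le_image_sub_of_le_deriv (f := φ)
    (C := σ * Real.exp ((α + 1) * x.1.re))
    (fun s _ => (hφ s).continuousAt.continuousWithinAt)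
    (fun s _ => (hφ s).differentiableAt.differentiableWithinAt) (fun s hs => ?_)
    0 self_mem_Ici t ht ht
  · simpa [φ] using h
  · rw [interior_Ici] at hs
    rw [(hφ s).deriv]
    have hs' : 0 ≤ s := le_of_lt hs
    refine le_trans ?_ (hphase _ (forwardInvariant_sectorDomain x hx s hs'))
    refine mul_le_mul_of_nonneg_left (Real.exp_le_exp.2 ?_) hσ
    refine mul_le_mul_of_nonneg_left ?_ (by linarith)
    simpa using hs'

theorem sectorDomain_anti {M' : ℝ} (h : M ≤ M') :
    sectorDomain α k η M' r ⊆ sectorDomain α k η M r := fun _ hx => ⟨h.trans_lt hx.1, hx.2⟩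

/-- The amplitude equation satisfies the kernel estimate far out in every subsector. -/
theorem exists_kernelBound (hα : 0 < α) (k : ℤ) (hη : 0 < η) (hη' : η < Real.pi / (2 * α + 2))
    (hr : 0 ≤ r) :
    ∃ (M A : ℝ) (β : ℂ × ℂ × ℂ → ℝ), KernelBound (sectorDomain α k η M r) (wkbPhase α k)
      (fun x => 2 * momentum α k x + (α + 1)) (wkbDefect α k) β A (eExp α) := by
  have hσ := sin_pos_of_width hα hη hη'
  obtain ⟨M₀, hphase⟩ := exists_re_phase_ge hα k hη hη' r
  obtain ⟨C, hC, hV⟩ := exists_norm_wkbDefect_le hα k hr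
  set σ := Real.sin ((α + 1) * η) with hσdef
  have he := eExp_pos hα
  set A := 2 * C / σ with hA
  have hA0 : 0 ≤ A := by positivity
  have hlim1 : Tendsto (fun ρ : ℝ => A / eExp α * Real.exp (-eExp α * ρ)) atTop (𝓝 0) :=
    tendsto_const_mul_exp_neg _ he
  have hlim2 : Tendsto (fun ρ : ℝ => σ / 2 * Real.exp ((α + 1) * ρ)) atTop atTop :=
    (Real.tendsto_exp_atTop.comp (tendsto_id.const_mul_atTop (by linarith))).const_mul_atTop
      (half_pos hσ)
  obtain ⟨M₁, hM₁⟩ := eventually_atTop.1 ((hlim1.eventually (gt_mem_nhds one_half_pos)).and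
    (hlim2.eventually_ge_atTop (α + 1 - eExp α)))
  -- Half of the decay rate `σ exp ((α + 1) ρ)` is kept as `β`; beyond `M₁` the other half absorbs
  -- the growth of `V` along the ray. `A = 2 C / σ` rewrites `C exp ((α + 1) ρ)` as `A β`, and the
  -- `0` ensures `ρ ≥ 0` for the bound on `V`.
  refine ⟨max (max M₀ M₁) 0, A, fun x => σ / 2 * Real.exp ((α + 1) * x.1.re), ?_⟩
  have hM0 : M₀ ≤ max (max M₀ M₁) 0 := (le_max_left _ _).trans (le_max_left _ _)
  have hM1 : M₁ ≤ max (max M₀ M₁) 0 := (le_max_right _ _).trans (le_max_left _ _)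
  exact
    { isOpen := isOpen_sectorDomain
      invariant := forwardInvariant_sectorDomain
      differentiableOn_H := (wkbPhase_differentiable k).differentiableOn
      hasDerivAt_H := fun x _ => wkbPhase_hasDerivAt k hα x
      continuousOn_H' := by
        have := (momentum_differentiable (α := α) k).continuous
        exact Continuous.continuousOn (by fun_prop)
      differentiableOn_V := (wkbDefect_differentiable k).differentiableOn
      continuousOn_β := Continuous.continuousOn (by fun_prop)
      β_pos := fun x _ => by positivity
      A_nonneg := hA0
      e_pos := he
      norm_le := by
        intro x hx t ht
        have h1 := re_phase_sub_ge hα hσ.le hphase (sectorDomain_anti hM0 hx) ht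
        have hρ : 0 ≤ x.1.re := (le_max_right _ _).trans hx.1.le
        have h2 := hV (x.1 + t, x.2) (by simpa using add_nonneg hρ ht) hx.2.2
        have h3 := (hM₁ x.1.re (hM1.trans hx.1.le)).2
        rw [norm_mul, Complex.norm_exp, Complex.sub_re]
        calc _ ≤ Real.exp (-(σ * Real.exp ((α + 1) * x.1.re) * t)) *
              (C * Real.exp ((α + 1 - eExp α) * (x.1.re + t))) := by
              refine mul_le_mul (Real.exp_le_exp.2 (by linarith)) (by simpa using h2)
                (norm_nonneg _) (Real.exp_pos _).le
          _ = C * Real.exp (-(σ * Real.exp ((α + 1) * x.1.re) * t) +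
              (α + 1 - eExp α) * (x.1.re + t)) := by
              rw [Real.exp_add]
              ring
          _ ≤ C * Real.exp (-eExp α * x.1.re + (α + 1) * x.1.re +
              -(σ / 2 * Real.exp ((α + 1) * x.1.re)) * t) := by
              refine mul_le_mul_of_nonneg_left (Real.exp_le_exp.2 ?_) hC
              have := mul_le_mul_of_nonneg_right h3 ht
              linarith
          _ = _ := by
              rw [Real.exp_add, Real.exp_add, hA]
              field_simp
      small := fun x hx => (hM₁ x.1.re (hM1.trans hx.1.le)).1.le }

end Estimates

/-! ### Wronskians and fundamental systems. -/

section LinearEquation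

/-- The pair `(φ, φ₁)` solves `φ' = φ₁`, `φ₁' = φ₁ + Q φ` on `U`. -/
def SolvesOn (Q : ℂ → ℂ) (U : Set ℂ) (φ φ₁ : ℂ → ℂ) : Prop :=
  ∀ p ∈ U, HasDerivAt φ (φ₁ p) p ∧ HasDerivAt φ₁ (φ₁ p + Q p * φ p) p

variable {Q : ℂ → ℂ} {U : Set ℂ} {φ φ₁ ψ ψ₁ : ℂ → ℂ}

theorem SolvesOn.mono {V : Set ℂ} (h : SolvesOn Q U φ φ₁) (hV : V ⊆ U) : SolvesOn Q V φ φ₁ :=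
  fun p hp => h p (hV hp)

theorem SolvesOn.const_mul (h : SolvesOn Q U φ φ₁) (c : ℂ) :
    SolvesOn Q U (fun p => c * φ p) fun p => c * φ₁ p := fun p hp =>
  ⟨(h p hp).1.const_mul c, ((h p hp).2.const_mul c).congr_deriv (by ring)⟩

theorem SolvesOn.add (h : SolvesOn Q U φ φ₁) (h' : SolvesOn Q U ψ ψ₁) :
    SolvesOn Q U (fun p => φ p + ψ p) fun p => φ₁ p + ψ₁ p := fun p hp =>
  ⟨(h p hp).1.add (h' p hp).1, ((h p hp).2.add (h' p hp).2).congr_deriv (by ring)⟩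

theorem SolvesOn.sub (h : SolvesOn Q U φ φ₁) (h' : SolvesOn Q U ψ ψ₁) :
    SolvesOn Q U (fun p => φ p - ψ p) fun p => φ₁ p - ψ₁ p := fun p hp =>
  ⟨(h p hp).1.sub (h' p hp).1, ((h p hp).2.sub (h' p hp).2).congr_deriv (by ring)⟩

/-- The Wronskian, normalised to be constant. -/
theorem SolvesOn.wronskian_eq (hU : IsOpen U) (hU' : IsPreconnected U) (h : SolvesOn Q U φ φ₁)
    (h' : SolvesOn Q U ψ ψ₁) {p q : ℂ} (hp : p ∈ U) (hq : q ∈ U) :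
    Complex.exp (-p) * (φ p * ψ₁ p - φ₁ p * ψ p) =
      Complex.exp (-q) * (φ q * ψ₁ q - φ₁ q * ψ q) := by
  have hd : ∀ p ∈ U, HasDerivAt (fun p => Complex.exp (-p) * (φ p * ψ₁ p - φ₁ p * ψ p)) 0 p := by
    intro p hp
    obtain ⟨a1, a2⟩ := h p hp
    obtain ⟨b1, b2⟩ := h' p hp
    refine ((hasDerivAt_neg p).cexp.mul ((a1.mul b2).sub (a2.mul b1))).congr_deriv ?_
    simp only [Pi.mul_apply, Pi.sub_apply]
    ring
  exact hU.is_const_of_deriv_eq_zero hU'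
    (fun p hp => (hd p hp).differentiableAt.differentiableWithinAt)
    (fun p hp => (hd p hp).deriv) hp hq

theorem exists_fundamental_system {P : Type*} [NormedAddCommGroup P] [NormedSpace ℂ P]
    [FiniteDimensional ℂ P] {Q : ℂ × P → ℂ} (hQ : Differentiable ℂ Q) (p₀ : ℂ) (y₀ : ℂ × ℂ) :
    ∃ φ φ₁ : ℂ × P → ℂ, Differentiable ℂ φ ∧ Differentiable ℂ φ₁ ∧
      (∀ ξ, φ (p₀, ξ) = y₀.1 ∧ φ₁ (p₀, ξ) = y₀.2) ∧
      ∀ ξ, SolvesOn (fun p => Q (p, ξ)) univ (fun p => φ (p, ξ)) fun p => φ₁ (p, ξ) := by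
  let S := ContinuousLinearMap.snd ℂ ℂ ℂ
  let A : ℂ × P → (ℂ × ℂ) →L[ℂ] (ℂ × ℂ) := fun x =>
    S.prod S + Q x • ContinuousLinearMap.prod 0 (ContinuousLinearMap.fst ℂ ℂ ℂ)
  have hA : Differentiable ℂ A := (hQ.smul_const _).const_add _
  obtain ⟨Y, hY, h0, hder⟩ := exists_entire_solution p₀ hA y₀
  refine ⟨fun x => (Y x).1, fun x => (Y x).2, hY.fst, hY.snd, fun ξ => ?_, fun ξ p _ => ?_⟩
  · simp [h0 ξ]
  · have h := hder p ξ
    constructor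
    · refine ((ContinuousLinearMap.fst ℂ ℂ ℂ).hasFDerivAt.comp_hasDerivAt p h).congr_deriv ?_
      simp [A, S]
    · refine ((ContinuousLinearMap.snd ℂ ℂ ℂ).hasFDerivAt.comp_hasDerivAt p h).congr_deriv ?_
      simp [A, S]

/-- A solution with vanishing initial data vanishes. -/
theorem SolvesOn.eq_zero (hQ : Differentiable ℂ Q) (hU : IsOpen U) (hU' : IsPreconnected U)
    (h : SolvesOn Q U φ φ₁) {p₀ : ℂ} (hp₀ : p₀ ∈ U) (h0 : φ p₀ = 0) (h1 : φ₁ p₀ = 0) :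
    ∀ p ∈ U, φ p = 0 := by
  intro p hp
  obtain ⟨a, a₁, -, -, ha0, ha⟩ := exists_fundamental_system (P := ℂ)
    (Q := fun x => Q x.1) (by fun_prop) p₀ (1, 0)
  obtain ⟨b, b₁, -, -, hb0, hb⟩ := exists_fundamental_system (P := ℂ)
    (Q := fun x => Q x.1) (by fun_prop) p₀ (0, 1)
  have ha' := (ha 0).mono (subset_univ U)
  have hb' := (hb 0).mono (subset_univ U)
  have e1 := h.wronskian_eq hU hU' ha' hp hp₀
  have e2 := h.wronskian_eq hU hU' hb' hp hp₀
  have e3 := ha'.wronskian_eq hU hU' hb' hp hp₀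
  have hne := Complex.exp_ne_zero (-p)
  rw [h0, h1] at e1 e2
  rw [(ha0 0).1, (ha0 0).2, (hb0 0).1, (hb0 0).2] at e3
  simp only [zero_mul, sub_zero, mul_zero, mul_eq_zero, hne, false_or, mul_one]
    at e1 e2 e3
  -- With `W` the Wronskian, `φ W(a, b) = a W(φ, b) - b W(φ, a)`; the right side vanishes and `W(a,
  -- b)` does not.
  have e4 : φ p * Complex.exp (-p₀) = 0 := by
    rw [← e3]
    linear_combination Complex.exp (-p) * (a (p, 0) * e2 - b (p, 0) * e1)
  exact (mul_eq_zero.1 e4).resolve_right (Complex.exp_ne_zero _)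

end LinearEquation

/-! ### Translation between the variables `x` and `log x`. -/

section Solutions

variable {α : ℝ} {k : ℤ} {E l : ℂ} {ψ φ : Cover → ℂ}

theorem logPotential_differentiable : Differentiable ℂ (logPotential α) := by
  unfold logPotential
  fun_prop

theorem logPotential_eq (p : ℂ) :
    logPotential α (p, E, l) = Complex.exp p ^ 2 * potential α E l p := by
  have hne := Complex.exp_ne_zero p
  have h1 : Complex.exp (2 * (α + 1) * p) = Complex.exp p ^ 2 * Complex.exp (2 * α * p) := by
    rw [← Complex.exp_nat_mul, ← Complex.exp_add]
    push_cast
    ring_nf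
  have h2 : Complex.exp (2 * p) = Complex.exp p ^ 2 := by
    rw [← Complex.exp_nat_mul]
    push_cast
    ring_nf
  simp only [logPotential, potential, Cover.pow, Cover.log, Cover.proj]
  rw [h1, h2]
  push_cast
  field_simp

/-- The equation in the variable `log x`. -/
theorem isSolution_iff : IsSolution α E l ψ ↔
    ∃ ψ₁ : ℂ → ℂ, SolvesOn (fun p => logPotential α (p, E, l)) univ ψ ψ₁ := by
  -- Since `d/dx = exp (-p) d/dp`, the second `x`-derivative is `(ψ'' - ψ') / x ^ 2`.
  have key : ∀ ψ₁ ψ₂ : ℂ → ℂ, (∀ p, HasDerivAt ψ (ψ₁ p) p) → (∀ p, HasDerivAt ψ₁ (ψ₂ p) p) →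
      ∀ p, xDeriv (xDeriv ψ) p = (ψ₂ p - ψ₁ p) / Complex.exp p ^ 2 := by
    intro ψ₁ ψ₂ h1 h2 p
    have e1 : xDeriv ψ = fun q => ψ₁ q / Complex.exp q := by
      funext q
      rw [xDeriv, (h1 q).deriv, Cover.proj]
    have hne := Complex.exp_ne_zero p
    have e2 : HasDerivAt (fun q => ψ₁ q / Complex.exp q) _ p :=
      (h2 p).div (Complex.hasDerivAt_exp p) hne
    rw [e1, xDeriv, e2.deriv, Cover.proj]
    field_simp
  constructor
  · rintro ⟨hd, hψ⟩
    have hd2 : Differentiable ℂ (deriv ψ) := by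
      rw [← differentiableOn_univ] at hd ⊢
      exact hd.deriv isOpen_univ
    refine ⟨deriv ψ, fun p _ => ⟨(hd p).hasDerivAt, (hd2 p).hasDerivAt.congr_deriv ?_⟩⟩
    have h := key (deriv ψ) (deriv (deriv ψ)) (fun p => (hd p).hasDerivAt)
      (fun p => (hd2 p).hasDerivAt) p
    rw [hψ p, eq_div_iff (pow_ne_zero 2 (Complex.exp_ne_zero p))] at h
    change _ = _ + logPotential α (p, E, l) * _
    rw [logPotential_eq]
    linear_combination -h
  · rintro ⟨ψ₁, h⟩
    refine ⟨fun p => (h p (mem_univ p)).1.differentiableAt, fun p => ?_⟩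
    rw [key ψ₁ _ (fun p => (h p (mem_univ p)).1) (fun p => (h p (mem_univ p)).2) p,
      div_eq_iff (pow_ne_zero 2 (Complex.exp_ne_zero p))]
    change _ + logPotential α (p, E, l) * _ - _ = _
    rw [logPotential_eq]
    ring

/-- The WKB ansatz turns the amplitude equation into the Schrödinger equation. -/
theorem solvesOn_of_amplitude (hα : 0 < α) {Ω : Set (ℂ × ℂ × ℂ)} {z u : ℂ × ℂ × ℂ → ℂ}
    (h : ∀ x ∈ Ω, HasDerivAt (fun q => z (q, x.2)) (u x) x.1 ∧
      HasDerivAt (fun q => u (q, x.2))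
        ((2 * momentum α k x + (α + 1)) * u x + wkbDefect α k x * z x) x.1) (ξ : ℂ × ℂ) :
    SolvesOn (fun p => logPotential α (p, ξ)) {p | (p, ξ) ∈ Ω}
      (fun p => Complex.exp (wkbExponent α k (p, ξ)) * z (p, ξ))
      fun p => Complex.exp (wkbExponent α k (p, ξ)) *
        (u (p, ξ) + (-(α / 2) - momentum α k (p, ξ)) * z (p, ξ)) := by
  intro p hp
  obtain ⟨hz, hu⟩ := h (p, ξ) hp
  have hg := (wkbExponent_hasDerivAt k hα (p, ξ)).cexp
  have hw := (momentum_hasDerivAt (α := α) k (p, ξ)).const_sub (-((α : ℂ) / 2))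
  have hV := wkbDefect_eq α k (p, ξ)
  dsimp only at hz hu hg hw
  refine ⟨(hg.mul hz).congr_deriv (by ring), (hg.mul (hu.add (hw.mul hz))).congr_deriv ?_⟩
  simp only [Pi.mul_apply, Pi.add_apply]
  rw [hV]
  ring

theorem sibuya_expression_eq (p : ℂ) (l : ℂ) :
    ψ p * Cover.pow p (α / 2) * Complex.exp ((-1) ^ k * truncatedAction α E p) =
      ψ p * Complex.exp (-wkbExponent α k (p, E, l)) := by
  rw [Cover.pow, Cover.log, mul_assoc, ← Complex.exp_add, wkbExponent]
  push_cast
  ring_nf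

theorem modulus_rpow (p : ℂ) (s : ℝ) : Cover.modulus p ^ (-s) = Real.exp (-s * p.re) := by
  rw [Cover.modulus, ← Real.exp_mul, mul_comm]

theorem closedSubsector_anti {ε ε' : ℝ} (h : ε' ≤ ε) :
    closedSubsector α k ε ⊆ closedSubsector α k ε' := fun p hp =>
  le_trans (b := Real.pi / (2 * α + 2) - ε) hp (by linarith)

theorem SibuyaBound.mono {ε ε' C C' M M' : ℝ} (h : SibuyaBound α k E ψ ε C M) (hε : ε ≤ ε')
    (hC : C ≤ C') (hM : M ≤ M') : SibuyaBound α k E ψ ε' C' M' := fun p hp hp' =>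
  (h p (closedSubsector_anti hε hp) (hM.trans hp')).trans
    (mul_le_mul_of_nonneg_right hC (Real.rpow_nonneg (Real.exp_pos _).le _))

end Solutions

/-! ### Uniqueness of the Sibuya solution. -/

section Uniqueness

variable {α : ℝ} {k : ℤ} {E l : ℂ} {ψ φ : Cover → ℂ} {ε C M : ℝ}

theorem SibuyaBound.norm_sub_one_le (h : SibuyaBound α k E ψ ε C M) (l : ℂ) {p : ℂ}
    (hp : |p.im - (k : ℝ) * Real.pi / (α + 1)| ≤ Real.pi / (2 * α + 2) - ε)
    (hp' : M ≤ Real.exp p.re) :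
    ‖ψ p * Complex.exp (-wkbExponent α k (p, E, l)) - 1‖ ≤ C * Real.exp (-eExp α * p.re) := by
  rw [← sibuya_expression_eq p l, ← modulus_rpow]
  exact h p hp hp'

/-- On the central ray, a function with Sibuya asymptotics has amplitude tending to `1` with
bounded derivative. -/
theorem SibuyaBound.amplitude (hα : 0 < α) (hε' : ε < Real.pi / (2 * α + 2))
    (h : SibuyaBound α k E ψ ε C M) {ψ₁ : ℂ → ℂ} (hψ : ∀ p, HasDerivAt ψ (ψ₁ p) p) (l : ℂ)
    {p₀ : ℂ} (hp₀ : p₀.im = (k : ℝ) * Real.pi / (α + 1)) :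
    Tendsto (fun t : ℝ => ψ (p₀ + t) * Complex.exp (-wkbExponent α k (p₀ + t, E, l))) atTop
      (𝓝 1) ∧
    ∃ K : ℝ, ∀ᶠ t : ℝ in atTop,
      ‖ψ (p₀ + t) * Complex.exp (-wkbExponent α k (p₀ + t, E, l))‖ ≤ K ∧
      ‖(ψ₁ (p₀ + t) - (-(α / 2) - momentum α k (p₀ + t, E, l)) * ψ (p₀ + t)) *
        Complex.exp (-wkbExponent α k (p₀ + t, E, l))‖ ≤ K := by
  set w := Real.pi / (2 * α + 2) - ε with hw
  have hw0 : 0 < w := by rw [hw]; linarith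
  let v : ℂ → ℂ := fun p => ψ p * Complex.exp (-wkbExponent α k (p, E, l))
  have hv : ∀ p, HasDerivAt v ((ψ₁ p - (-(α / 2) - momentum α k (p, E, l)) * ψ p) *
      Complex.exp (-wkbExponent α k (p, E, l))) p := by
    intro p
    refine ((hψ p).mul (wkbExponent_hasDerivAt k hα (p, E, l)).neg.cexp).congr_deriv ?_
    simp only [Pi.neg_apply]
    ring
  have hlim : Tendsto (fun ρ : ℝ => C * Real.exp (-eExp α * ρ)) atTop (𝓝 0) :=
    tendsto_const_mul_exp_neg C (eExp_pos hα)
  have hev : ∀ᶠ ρ : ℝ in atTop, M ≤ Real.exp ρ ∧ C * Real.exp (-eExp α * ρ) < 1 :=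
    (Real.tendsto_exp_atTop.eventually_ge_atTop M).and (hlim.eventually (gt_mem_nhds one_pos))
  obtain ⟨ρ₁, hρ₁⟩ := eventually_atTop.1 hev
  have hle : ∀ p : ℂ, |p.im - (k : ℝ) * Real.pi / (α + 1)| ≤ w → ρ₁ ≤ p.re →
      ‖v p - 1‖ ≤ C * Real.exp (-eExp α * p.re) := fun p hp hp' =>
    h.norm_sub_one_le l hp (hρ₁ _ hp').1
  have hle2 : ∀ p : ℂ, |p.im - (k : ℝ) * Real.pi / (α + 1)| ≤ w → ρ₁ ≤ p.re → ‖v p‖ ≤ 2 := by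
    intro p hp hp'
    have h1 := (hle p hp hp').trans (hρ₁ _ hp').2.le
    have h2 := norm_le_norm_add_norm_sub' (v p) 1
    rw [norm_one] at h2
    linarith
  have hre : Tendsto (fun t : ℝ => p₀.re + t) atTop atTop :=
    tendsto_atTop_add_const_left _ _ tendsto_id
  have haxis : ∀ t : ℝ, |(p₀ + (t : ℂ)).im - (k : ℝ) * Real.pi / (α + 1)| ≤ w := by
    intro t
    simp [hp₀, hw0.le]
  constructor
  · rw [tendsto_iff_norm_sub_tendsto_zero]
    refine squeeze_zero' (Eventually.of_forall fun t => norm_nonneg _) ?_ (hlim.comp hre)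
    filter_upwards [hre.eventually_ge_atTop ρ₁] with t ht
    simpa using hle (p₀ + t) (haxis t) (by simpa using ht)
  · refine ⟨max 2 (2 / w), ?_⟩
    -- A closed disc of radius `w` centred on the axis stays in the subsector, and the margin `w`
    -- keeps it beyond `ρ₁`; the bound `2` there gives `2 / w` by Cauchy.
    filter_upwards [hre.eventually_ge_atTop (ρ₁ + w)] with t ht
    constructor
    · refine (hle2 (p₀ + t) (haxis t) ?_).trans (le_max_left _ _)
      simp only [Complex.add_re, Complex.ofReal_re]
      linarith
    · refine le_trans ?_ (le_max_right _ _)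
      rw [← (hv (p₀ + t)).deriv]
      refine Complex.norm_deriv_le_of_forall_mem_sphere_norm_le hw0
        (Differentiable.diffContOnCl fun p => (hv p).differentiableAt) fun q hq => ?_
      rw [mem_sphere, dist_eq_norm] at hq
      have h1 := Complex.abs_re_le_norm (q - (p₀ + t))
      have h2 := Complex.abs_im_le_norm (q - (p₀ + t))
      rw [hq] at h1 h2
      simp only [Complex.sub_re, Complex.sub_im, Complex.add_re, Complex.add_im,
        Complex.ofReal_re, Complex.ofReal_im, add_zero] at h1 h2
      refine hle2 q (by rwa [← hp₀]) ?_
      have := (abs_le.1 h1).1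
      linarith

/-- Shows that the normalised Wronskian of two functions `exp (wkbExponent)` times an amplitude
carries the factor `exp (-wkbPhase)`. -/
theorem two_mul_wkbExponent_sub (x : ℂ × ℂ × ℂ) :
    2 * wkbExponent α k x - x.1 = -wkbPhase α k x := by
  simp only [wkbExponent, wkbPhase]
  ring

/-- A solution is determined by its asymptotics in one subsector of positive opening. -/
theorem eq_of_sibuyaBound (hα : 0 < α) (hε : 0 < ε) (hε' : ε < Real.pi / (2 * α + 2))
    (hφ : IsSolution α E l φ) (hψ : IsSolution α E l ψ) {C' M' : ℝ}
    (hφb : SibuyaBound α k E φ ε C M) (hψb : SibuyaBound α k E ψ ε C' M') : φ = ψ := by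
  obtain ⟨φ₁, hφs⟩ := isSolution_iff.1 hφ
  obtain ⟨ψ₁, hψs⟩ := isSolution_iff.1 hψ
  obtain ⟨M₀, hphase⟩ := exists_re_phase_ge hα k hε hε' (‖(E, l)‖ + 1)
  have hσ := sin_pos_of_width hα hε hε'
  set p₀ : ℂ := ⟨M₀ + 1, (k : ℝ) * Real.pi / (α + 1)⟩ with hp₀
  have hmem : (p₀, E, l) ∈ sectorDomain α k ε M₀ (‖(E, l)‖ + 1) := by
    refine ⟨by simp [hp₀], by simpa [hp₀] using hε', ?_⟩
    rw [mem_ball_zero_iff]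
    exact lt_add_one _
  obtain ⟨hφ1, K, hφK⟩ := hφb.amplitude hα hε' (fun p => (hφs p (mem_univ p)).1) l
    (p₀ := p₀) rfl
  obtain ⟨hψ1, K', hψK⟩ := hψb.amplitude hα hε' (fun p => (hψs p (mem_univ p)).1) l
    (p₀ := p₀) rfl
  have hH : Tendsto (fun t : ℝ => (wkbPhase α k (p₀ + t, E, l)).re) atTop atTop := by
    have hpos : 0 < Real.sin ((α + 1) * ε) * Real.exp ((α + 1) * p₀.re) := by positivity
    refine tendsto_atTop_mono' _ ?_ (tendsto_atTop_add_const_left _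
      (wkbPhase α k (p₀, E, l)).re (tendsto_id.const_mul_atTop hpos))
    filter_upwards [eventually_ge_atTop 0] with t ht
    have := re_phase_sub_ge hα hσ.le hphase hmem ht
    simp only [id]
    linarith
  -- The normalised Wronskian is constant, yet on the central ray it is `exp (-wkbPhase)` times a
  -- bounded quantity, and the real part of the phase tends to infinity.
  have hW : ∀ p, φ p * ψ₁ p - φ₁ p * ψ p = 0 := by
    have hconst : ∀ p : ℂ, Complex.exp (-p) * (φ p * ψ₁ p - φ₁ p * ψ p) =
        Complex.exp (-p₀) * (φ p₀ * ψ₁ p₀ - φ₁ p₀ * ψ p₀) := fun p =>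
      hφs.wronskian_eq isOpen_univ isPreconnected_univ hψs (mem_univ _) (mem_univ _)
    have hlim : Tendsto (fun t : ℝ =>
        Real.exp (-(wkbPhase α k (p₀ + t, E, l)).re) * (K * K' + K * K')) atTop (𝓝 0) := by
      simpa using (Real.tendsto_exp_neg_atTop_nhds_zero.comp hH).mul_const (K * K' + K * K')
    have hle : ‖Complex.exp (-p₀) * (φ p₀ * ψ₁ p₀ - φ₁ p₀ * ψ p₀)‖ ≤ 0 := by
      refine ge_of_tendsto hlim ?_
      filter_upwards [hφK, hψK] with t ⟨a1, a2⟩ ⟨b1, b2⟩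
      rw [← hconst (p₀ + t)]
      set p : ℂ := p₀ + t with hp
      set g := wkbExponent α k (p, E, l) with hg
      have e1 : Complex.exp (-p) = Complex.exp (-wkbPhase α k (p, E, l)) *
          (Complex.exp (-g) * Complex.exp (-g)) := by
        rw [← two_mul_wkbExponent_sub, ← Complex.exp_add, ← Complex.exp_add, hg]
        ring_nf
      have e2 : Complex.exp (-p) * (φ p * ψ₁ p - φ₁ p * ψ p) =
          Complex.exp (-wkbPhase α k (p, E, l)) *
          ((φ p * Complex.exp (-g)) * ((ψ₁ p - (-(α / 2) - momentum α k (p, E, l)) * ψ p) *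
            Complex.exp (-g)) - ((φ₁ p - (-(α / 2) - momentum α k (p, E, l)) * φ p) *
            Complex.exp (-g)) * (ψ p * Complex.exp (-g))) := by
        rw [e1]
        ring
      rw [e2, norm_mul, Complex.norm_exp, Complex.neg_re]
      refine mul_le_mul_of_nonneg_left ((norm_sub_le _ _).trans ?_) (Real.exp_pos _).le
      exact add_le_add
        ((norm_mul_le _ _).trans (mul_le_mul a1 b2 (norm_nonneg _) ((norm_nonneg _).trans a1)))
        ((norm_mul_le _ _).trans (mul_le_mul a2 b1 (norm_nonneg _) ((norm_nonneg _).trans a2)))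
    intro p
    rw [← hconst p] at hle
    exact (mul_eq_zero.1 (norm_le_zero_iff.1 hle)).resolve_left (Complex.exp_ne_zero _)
  obtain ⟨t₁, ht₁⟩ := (hψ1.eventually_ne one_ne_zero).exists
  set p₁ : ℂ := p₀ + t₁
  have hne : ψ p₁ ≠ 0 := left_ne_zero_of_mul ht₁
  set c : ℂ := φ p₁ / ψ p₁ with hc
  -- At `p₁` the difference vanishes by the choice of `c`, and its derivative by the vanishing
  -- Wronskian.
  have hφc : ∀ p, φ p = c * ψ p := fun p => sub_eq_zero.1 <|
    (hφs.sub (hψs.const_mul c)).eq_zero (logPotential_differentiable.comp (by fun_prop))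
      isOpen_univ isPreconnected_univ (mem_univ p₁)
      (by rw [hc, div_mul_cancel₀ _ hne, sub_self])
      (by
        rw [hc, sub_eq_zero, div_mul_eq_mul_div, eq_div_iff hne]
        linear_combination -(hW p₁)) p (mem_univ p)
  have hc1 : c = 1 := by
    refine tendsto_nhds_unique ?_ hφ1
    have := hψ1.const_mul c
    rw [mul_one] at this
    exact this.congr fun t => by rw [hφc, mul_assoc]
  funext p
  rw [hφc, hc1, one_mul]

end Uniqueness

/-! ### Construction, continuation and gluing of the solutions. -/

section Existence

variable {α : ℝ}

/-- The fiber is the convex intersection of a half plane and a strip, or empty. -/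
theorem isPreconnected_sectorDomain_fiber (k : ℤ) (η M r : ℝ) (ξ : ℂ × ℂ) :
    IsPreconnected {p : ℂ | (p, ξ) ∈ sectorDomain α k η M r} := by
  by_cases hξ : ξ ∈ ball (0 : ℂ × ℂ) r
  · have h1 : Convex ℝ {p : ℂ | M < p.re} := convex_halfSpace_re_gt M
    have h2 : Convex ℝ (Complex.imLm ⁻¹'
        ball ((k : ℝ) * Real.pi / (α + 1)) (Real.pi / (2 * α + 2) - η)) :=
      (convex_ball _ _).linear_preimage Complex.imLm
    convert (h1.inter h2).isPreconnected using 1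
    ext p
    simp only [sectorDomain, mem_ofPred_eq, mem_inter_iff, mem_preimage, Complex.imLm_coe,
      hξ, and_true, mem_ball (y := p.im), Real.dist_eq]
  · convert isPreconnected_empty
    ext p
    simp only [sectorDomain, mem_ofPred_eq, mem_empty_iff_false, iff_false]
    exact fun h => hξ h.2.2

/-- Existence of the Sibuya solution, for bounded parameters and in one subsector. -/
theorem exists_sibuya_of_bounded (hα : 0 < α) (k : ℤ) {ε r : ℝ} (hε : 0 < ε)
    (hε' : ε < Real.pi / (2 * α + 2)) (hr : 0 ≤ r) :
    ∃ (Φ : ℂ × ℂ × ℂ → ℂ) (C M : ℝ),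
      (∀ E l, (E, l) ∈ ball (0 : ℂ × ℂ) r → IsSolution α E l (fun p => Φ (p, E, l)) ∧
        SibuyaBound α k E (fun p => Φ (p, E, l)) ε C M) ∧
      ∀ p, DifferentiableOn ℂ (fun ξ => Φ (p, ξ)) (ball 0 r) := by
  -- With margin `ε / 2` the open domain contains the far part of the closed subsector of margin
  -- `ε`.
  obtain ⟨M, A, β, hker⟩ := exists_kernelBound hα k (half_pos hε)
    ((half_lt_self hε).trans hε') hr
  obtain ⟨z, u, hz, hu, hzu⟩ := hker.exists_recessive
  set Ω := sectorDomain α k (ε / 2) M r with hΩ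
  let ψ : ℂ × ℂ × ℂ → ℂ := fun x => Complex.exp (wkbExponent α k x) * z x
  let ψ₁ : ℂ × ℂ × ℂ → ℂ := fun x => Complex.exp (wkbExponent α k x) *
    (u x + (-(α / 2) - momentum α k x) * z x)
  have hψd : DifferentiableOn ℂ ψ Ω :=
    (wkbExponent_differentiable k).cexp.differentiableOn.mul hz
  have hψ₁d : DifferentiableOn ℂ ψ₁ Ω :=
    (wkbExponent_differentiable k).cexp.differentiableOn.mul (hu.add
      (((momentum_differentiable k).const_sub _).differentiableOn.mul hz))
  have hψs : ∀ ξ, SolvesOn (fun p => logPotential α (p, ξ)) {p | (p, ξ) ∈ Ω}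
      (fun p => ψ (p, ξ)) fun p => ψ₁ (p, ξ) :=
    solvesOn_of_amplitude hα fun x hx => ⟨(hzu x hx).1, (hzu x hx).2.1⟩
  set p₀ : ℂ := ⟨M + 1, (k : ℝ) * Real.pi / (α + 1)⟩ with hp₀
  have hmem : ∀ ξ ∈ ball (0 : ℂ × ℂ) r, (p₀, ξ) ∈ Ω := by
    intro ξ hξ
    refine ⟨by simp [hp₀], ?_, hξ⟩
    have := (half_lt_self hε).trans hε'
    simpa [hp₀] using this
  obtain ⟨a, a₁, had, -, ha0, has⟩ := exists_fundamental_system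
    (logPotential_differentiable (α := α)) p₀ (1, 0)
  obtain ⟨b, b₁, hbd, -, hb0, hbs⟩ := exists_fundamental_system
    (logPotential_differentiable (α := α)) p₀ (0, 1)
  -- Cauchy data at `p₀` depend holomorphically on the parameters, and `a`, `b` are entire, so this
  -- continuation to the whole cover is holomorphic in the parameters.
  let Φ : ℂ × ℂ × ℂ → ℂ := fun x => ψ (p₀, x.2) * a x + ψ₁ (p₀, x.2) * b x
  have hΦs : ∀ ξ, SolvesOn (fun p => logPotential α (p, ξ)) univ (fun p => Φ (p, ξ))
      fun p => ψ (p₀, ξ) * a₁ (p, ξ) + ψ₁ (p₀, ξ) * b₁ (p, ξ) := fun ξ =>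
    ((has ξ).const_mul (ψ (p₀, ξ))).add ((hbs ξ).const_mul (ψ₁ (p₀, ξ)))
  have hΦψ : ∀ x ∈ Ω, Φ x = ψ x := by
    rintro ⟨p, ξ⟩ hx
    have hU : IsOpen {p | (p, ξ) ∈ Ω} := isOpen_sectorDomain.preimage (by fun_prop)
    refine sub_eq_zero.1 ((((hΦs ξ).mono (subset_univ _)).sub (hψs ξ)).eq_zero
      (logPotential_differentiable.comp (by fun_prop)) hU
      (isPreconnected_sectorDomain_fiber k _ M r ξ) (p₀ := p₀) (hmem ξ hx.2.2) ?_ ?_ p hx)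
    · simp [Φ, ha0, hb0]
    · simp [ha0, hb0]
  -- `SibuyaBound` measures `|x| = exp (re p)`, hence the exponential; the `+ 1` gives the strict
  -- inequality `M < re p`.
  refine ⟨Φ, 2 * A / eExp α, Real.exp (M + 1), fun E l hξ => ⟨?_, ?_⟩, fun p => ?_⟩
  · exact isSolution_iff.2 ⟨_, hΦs (E, l)⟩
  · intro p hp hpM
    have hpM' : M + 1 ≤ p.re := Real.exp_le_exp.1 hpM
    have hx : (p, E, l) ∈ Ω := by
      refine ⟨by linarith, lt_of_le_of_lt (b := Real.pi / (2 * α + 2) - ε) hp ?_, hξ⟩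
      linarith
    have h := (hzu _ hx).2.2
    rw [sibuya_expression_eq (ψ := fun p => Φ (p, E, l)) p l, modulus_rpow, hΦψ _ hx]
    have e1 : ψ (p, E, l) * Complex.exp (-wkbExponent α k (p, E, l)) = z (p, E, l) := by
      have : Complex.exp (wkbExponent α k (p, E, l)) *
          Complex.exp (-wkbExponent α k (p, E, l)) = 1 := by
        rw [← Complex.exp_add, add_neg_cancel, Complex.exp_zero]
      simp only [ψ]
      linear_combination z (p, E, l) * this
    rw [e1]
    exact h
  · have h1 : DifferentiableOn ℂ (fun ξ : ℂ × ℂ => (p₀, ξ)) (ball 0 r) :=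
      Differentiable.differentiableOn (by fun_prop)
    have h2 : DifferentiableOn ℂ (fun ξ : ℂ × ℂ => (p, ξ)) (ball 0 r) :=
      Differentiable.differentiableOn (by fun_prop)
    exact ((hψd.comp h1 hmem).mul (had.comp_differentiableOn h2)).add
      ((hψ₁d.comp h1 hmem).mul (hbd.comp_differentiableOn h2))

theorem exists_mem_ball (W : Set (ℂ × ℂ)) (hW : IsCompact W) :
    ∃ r : ℝ, 0 ≤ r ∧ W ⊆ ball 0 r := by
  obtain ⟨r, hr⟩ := hW.isBounded.subset_ball (0 : ℂ × ℂ)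
  exact ⟨max r 0, le_max_right _ _, hr.trans (ball_subset_ball (le_max_left _ _))⟩

/-- The Sibuya solutions, uniform and holomorphic in the parameters. -/
theorem exists_sibuya (hα : 0 < α) (k : ℤ) :
    ∃ Ψ : ℂ → ℂ → Cover → ℂ,
      (∀ E l, IsSolution α E l (Ψ E l)) ∧
      (∀ ε : ℝ, 0 < ε → ∀ W : Set (ℂ × ℂ), IsCompact W →
        ∃ C M : ℝ, ∀ q ∈ W, SibuyaBound α k q.1 (Ψ q.1 q.2) ε C M) ∧
      ∀ p : Cover, Differentiable ℂ fun q : ℂ × ℂ => Ψ q.1 q.2 p := by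
  set w := Real.pi / (2 * α + 2) with hw
  have hw0 : 0 < w := by have := Real.pi_pos; positivity
  have hex : ∀ ξ : ℂ × ℂ, ∃ ψ : Cover → ℂ, IsSolution α ξ.1 ξ.2 ψ ∧
      ∃ C M : ℝ, SibuyaBound α k ξ.1 ψ (w / 2) C M := by
    intro ξ
    obtain ⟨Φ, C, M, h, -⟩ := exists_sibuya_of_bounded hα k (half_pos hw0) (half_lt_self hw0)
      (r := ‖ξ‖ + 1) (by positivity)
    obtain ⟨h1, h2⟩ := h ξ.1 ξ.2 (by simp)
    exact ⟨_, h1, C, M, h2⟩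
  choose Ψ hΨ C₀ M₀ hΨb using hex
  -- `Ψ` is chosen separately for each parameter; uniqueness in the subsector of margin `w / 2`
  -- identifies it with every local holomorphic family.
  have hagree : ∀ {ε r : ℝ} {Φ : ℂ × ℂ × ℂ → ℂ} {C M : ℝ}, ε ≤ w / 2 →
      (∀ E l, (E, l) ∈ ball (0 : ℂ × ℂ) r → IsSolution α E l (fun p => Φ (p, E, l)) ∧
        SibuyaBound α k E (fun p => Φ (p, E, l)) ε C M) →
      ∀ ξ ∈ ball (0 : ℂ × ℂ) r, Ψ ξ = fun p => Φ (p, ξ) := by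
    intro ε r Φ C M hε h ξ hξ
    obtain ⟨h1, h2⟩ := h ξ.1 ξ.2 hξ
    exact eq_of_sibuyaBound hα (half_pos hw0) (half_lt_self hw0) (hΨ ξ) h1 (hΨb ξ)
      (h2.mono hε le_rfl le_rfl)
  refine ⟨fun E l => Ψ (E, l), fun E l => hΨ (E, l), fun ε hε W hW => ?_, fun p ξ => ?_⟩
  · obtain ⟨r, hr, hWr⟩ := exists_mem_ball W hW
    -- The given `ε` may exceed the half-opening `w`; a smaller margin gives a larger subsector, and
    -- so a stronger estimate.
    have h0 : 0 < min ε (w / 2) := lt_min hε (half_pos hw0)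
    obtain ⟨Φ, C, M, h, -⟩ := exists_sibuya_of_bounded hα k h0
      ((min_le_right _ _).trans_lt (half_lt_self hw0)) hr
    refine ⟨C, M, fun ξ hξ => ?_⟩
    change SibuyaBound α k ξ.1 (Ψ ξ) ε C M
    rw [hagree (min_le_right _ _) h ξ (hWr hξ)]
    exact (h ξ.1 ξ.2 (hWr hξ)).2.mono (min_le_left _ _) le_rfl le_rfl
  · obtain ⟨Φ, C, M, h, hd⟩ := exists_sibuya_of_bounded hα k (half_pos hw0) (half_lt_self hw0)
      (r := ‖ξ‖ + 1) (by positivity)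
    have hξ : ξ ∈ ball (0 : ℂ × ℂ) (‖ξ‖ + 1) := by simp
    have hnhds := isOpen_ball.mem_nhds hξ
    refine ((hd p).differentiableAt hnhds).congr_of_eventuallyEq ?_
    filter_upwards [hnhds] with q hq
    exact congrFun (hagree le_rfl h q hq) p

end Existence

end AnharmonicOscillator

end

theorem mainTheorem5 (α : ℝ) (hα : 0 < α) :
    0 < AnharmonicOscillator.dExp α ∧
    ∀ k : ℤ, ∃ Ψ : ℂ → ℂ → AnharmonicOscillator.Cover → ℂ,
      (∀ E l : ℂ,
        AnharmonicOscillator.IsSolution α E l (Ψ E l) ∧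
        AnharmonicOscillator.HasSibuyaAsymptotics α k E (Ψ E l) ∧
        ∀ φ : AnharmonicOscillator.Cover → ℂ,
          AnharmonicOscillator.IsSolution α E l φ →
          AnharmonicOscillator.HasSibuyaAsymptotics α k E φ → φ = Ψ E l) ∧
      (∀ ε : ℝ, 0 < ε → ∀ W : Set (ℂ × ℂ), IsCompact W →
        ∃ C M : ℝ, ∀ q ∈ W, AnharmonicOscillator.SibuyaBound α k q.1 (Ψ q.1 q.2) ε C M) ∧
      (∀ p : AnharmonicOscillator.Cover, Differentiable ℂ fun q : ℂ × ℂ => Ψ q.1 q.2 p) := by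
  refine ⟨AnharmonicOscillator.dExp_pos hα, fun k => ?_⟩
  obtain ⟨Ψ, hsol, hbound, hdiff⟩ := AnharmonicOscillator.exists_sibuya hα k
  have hasym : ∀ E l : ℂ, AnharmonicOscillator.HasSibuyaAsymptotics α k E (Ψ E l) := by
    intro E l ε hε
    obtain ⟨C, M, h⟩ := hbound ε hε {(E, l)} isCompact_singleton
    exact ⟨C, M, h (E, l) rfl⟩
  refine ⟨Ψ, fun E l => ⟨hsol E l, hasym E l, fun φ hφ hφa => ?_⟩, hbound, hdiff⟩
  have hw : 0 < Real.pi / (2 * α + 2) := by have := Real.pi_pos; positivity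
  obtain ⟨C, M, h⟩ := hφa _ (half_pos hw)
  obtain ⟨C', M', h'⟩ := hasym E l _ (half_pos hw)
  exact AnharmonicOscillator.eq_of_sibuyaBound hα (half_pos hw) (half_lt_self hw) hφ (hsol E l) h h'
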